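/- **Definitions.** For probability measures $p,q$ on a measurable space $\mathcal X$ let $d_{\mathrm{TV}}(p,q)=\sup_S\,(p(S)-q(S))$, the supremum over measurable $S\subseteq\mathcal X$. A *protocol* with $t$ rounds and $n$ individuals, the $i$-th holding a data point $X_i\in\mathcal X$, works as follows: in round $r\in\{1,\dots,t\}$ every individual $i$ in a set $U_r\subseteq\{1,\dots,n\}$ of active individuals sends a message $m_{r,i}$, which is a randomized function (with fresh independent private randomness) of $X_i$ and of all messages sent in the previous rounds. The protocol is *$\varepsilon$-locally differentially private* ($\varepsilon$-LDP) if for all data vectors $x,y\in\mathcal X^n$ that differ in one coordinate and every measurable set $S$ of transcripts, $\Pr[M(x)\in S]\le e^{\varepsilon}\Pr[M(y)\in S]$, where $M(x)$ is the transcript, i.e. the collection of all messages sent on data $x$. It is *sequentially interactive* with $t$ rounds if $U_1,\dots,U_t$ are pairwise disjoint. **Theorem.** For every $\gamma>0$ there is a constant $C=C(\gamma)>0$ such that for all integers $k\ge 3$ and all $0<\varepsilon\le 1$, $\alpha>0$ there are integers $$0\le n\le C\,\frac{k\log k\,\log\log k}{\varepsilon^2\alpha^2},\qquad 0\le t\le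 C\log\log k,$$ with the following property. For every measurable space $\mathcal X$ and all probability measures $q_1,\dots,q_k$ on $\mathcal X$ there are a sequentially interactive $\varepsilon$-LDP protocol with $t$ rounds and $n$ individuals and a measurable output rule, which maps the transcript to some $\hat q\in\{q_1,\dots,q_k\}$, such that for every probability measure $p$ on $\mathcal X$, if $X_1,\dots,X_n$ are i.i.d. with law $p$, then with probability at least $9/10$ (over the data and the randomness of the protocol) $$d_{\mathrm{TV}}(p,\hat q)\le(27+\gamma)\min_{1\le i\le k}d_{\mathrm{TV}}(p,q_i)+\alpha .$$ -/

import Mathlib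

open MeasureTheory

/-- Total variation distance of two (probability) measures on `𝒳`: the supremum over all events `S`
of `p(S) - q(S)`. -/
noncomputable def tvDist {𝒳 : Type*} [MeasurableSpace 𝒳] (p q : Measure 𝒳) : ℝ :=
  ⨆ S : {S : Set 𝒳 // MeasurableSet S}, (p.real S.1 - q.real S.1)

/-- An interactive protocol with `t` rounds between `n` individuals, the `i`-th of whom holds a
single data point in `𝒳`.

In round `q` the individuals in `active q` speak. The individual `i` draws a fresh private coin
with law `coinLaw` (independent of everything else) and sends a message which is a function of
this coin, of the own data point and of the messages `m r j` (`r < q`, `j ∈ active r`) sent by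
all individuals in the previous rounds. -/
structure Protocol (𝒳 : Type*) [MeasurableSpace 𝒳] (n t : ℕ) where
  /-- the space of messages -/
  Msg : Type
  [measurableSpaceMsg : MeasurableSpace Msg]
  [standardBorelMsg : StandardBorelSpace Msg]
  /-- the space of private coins -/
  Coin : Type
  [measurableSpaceCoin : MeasurableSpace Coin]
  /-- the law of each private coin -/
  coinLaw : Measure Coin
  [isProbabilityMeasure_coinLaw : IsProbabilityMeasure coinLaw]
  /-- the set of individuals that are active in a given round -/
  active : Fin t → Finset (Fin n)
  /-- how an active individual computes the message from coin, data point and history -/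
  msg : (q : Fin t) → {i : Fin n // i ∈ active q} →
    Coin × 𝒳 × ((r : {r : Fin t // r < q}) → {j : Fin n // j ∈ active r.1} → Msg) → Msg
  measurable_msg : ∀ q i, Measurable (msg q i)

namespace Protocol

attribute [instance] measurableSpaceMsg standardBorelMsg measurableSpaceCoin
  isProbabilityMeasure_coinLaw

variable {𝒳 : Type*} [MeasurableSpace 𝒳] {n t : ℕ}

/-- The full record of all messages sent during the protocol. -/
abbrev Transcript (P : Protocol 𝒳 n t) : Type :=
  (q : Fin t) → {i : Fin n // i ∈ P.active q} → P.Msg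

/-- The messages that are sent when the data points are `x` and the private coin of individual `i`
in round `q` is `c q i`. -/
def transcript (P : Protocol 𝒳 n t) (x : Fin n → 𝒳) (c : Fin t → Fin n → P.Coin) :
    (q : Fin t) → {i : Fin n // i ∈ P.active q} → P.Msg
  | q => fun i => P.msg q i (c q i.1, x i.1, fun r j => P.transcript x c r.1 j)
termination_by q => q
decreasing_by exact r.2

/-- The joint law of all the (independent) private coins. -/
noncomputable def coins (P : Protocol 𝒳 n t) : Measure (Fin t → Fin n → P.Coin) :=
  Measure.pi fun _ => Measure.pi fun _ => P.coinLaw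

/-- The joint law of the data and the coins when the data points are i.i.d. with law `p`. -/
noncomputable def experiment (P : Protocol 𝒳 n t) (p : Measure 𝒳) :
    Measure ((Fin n → 𝒳) × (Fin t → Fin n → P.Coin)) :=
  (Measure.pi fun _ => p).prod P.coins

/-- `ε`-local differential privacy: the transcript, as a randomized function of the data
`x = (x₁, …, xₙ)`, is `ε`-differentially private. -/
def IsLDP (P : Protocol 𝒳 n t) (ε : ℝ) : Prop :=
  ∀ x y : Fin n → 𝒳, (∃ i, ∀ j, j ≠ i → x j = y j) →
    ∀ S : Set P.Transcript, MeasurableSet S →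
      P.coins.real {c | P.transcript x c ∈ S} ≤
        Real.exp ε * P.coins.real {c | P.transcript y c ∈ S}

/-- Sequential interactivity: the sets of active individuals of different rounds are disjoint. -/
def IsSequentiallyInteractive (P : Protocol 𝒳 n t) : Prop :=
  ∀ q r : Fin t, q ≠ r → Disjoint (P.active q) (P.active r)

end Protocol

/-! Write D(i) for the distance from p to hypothesis i. A Scheffé test of a pair estimates the
probability of one event and removes the hypothesis that fits worse; up to estimation error, i can
only lose to hypotheses within 2 D(i) (`dist_loser_le`). Testing all pairs is too expensive, so each
round tests a sparse graph on the remaining candidates V. By `exists_round` one can put aside O(s²)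
representatives and test at most s|V| pairs, such that both members of a tested pair at distance δ
are within 2δ of a representative, and an independent set has at most 2|V|/s points. Survivors are
independent, so V shrinks by a factor s/2. If the best hypothesis loses, some representative within
4 D(i) replaces it, at distance at most 5 D(i) from p. A minimum distance estimate among survivors
and representatives costs another factor 3 (`minDistance_le`), so the total factor is 15, below 27
(`selection_le`).

As V shrinks, s can grow doubly exponentially with O(k) tests per round: O(log log k) rounds leave
O(√k) candidates and representatives (`exists_schedule`).

Each query goes to a fresh group of individuals using randomized response. Adaptivity is handled by
Hoeffding's inequality and a union bound over every possible event in every query slot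
(`exists_protocol`), which costs O(log k/(ε²α²)) individuals per query. -/

/-! ### Sparse comparison graphs in finite metric spaces -/

section Combinatorics

variable {κ : Type*} [DecidableEq κ]

omit [DecidableEq κ] in
/-- The radius of the smallest ball around `i` which contains `b` points of `V`. -/
theorem exists_radius (d : κ → κ → ℝ) (hnn : ∀ i j, 0 ≤ d i j) (V : Finset κ) {b : ℕ}
    (hb : 1 ≤ b) (hbV : b ≤ V.card) (i : κ) :
    ∃ r : ℝ, 0 ≤ r ∧ b ≤ (V.filter fun j => d i j ≤ r).card ∧
      (V.filter fun j => d i j < r).card < b := by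
  have hV : V.Nonempty := Finset.card_pos.mp (by omega)
  obtain ⟨j₀, hj₀, hmax⟩ := V.exists_max_image (d i) hV
  have hne : (V.filter fun j => b ≤ (V.filter fun l => d i l ≤ d i j).card).Nonempty := by
    refine ⟨j₀, ?_⟩
    rw [Finset.mem_filter, Finset.filter_true_of_mem hmax]
    exact ⟨hj₀, hbV⟩
  obtain ⟨j, hj, hmin⟩ := Finset.exists_min_image _ (d i) hne
  rw [Finset.mem_filter] at hj
  refine ⟨d i j, hnn i j, hj.2, ?_⟩
  -- Otherwise the farthest point of the open ball would give a smaller admissible radius.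
  by_contra! hcon
  obtain ⟨l, hl, hlmax⟩ := Finset.exists_max_image (V.filter fun l => d i l < d i j) (d i)
    (Finset.card_pos.mp (by omega))
  rw [Finset.mem_filter] at hl
  have hlj := hmin l (Finset.mem_filter.mpr ⟨hl.1, hcon.trans (Finset.card_le_card fun x hx =>
    Finset.mem_filter.mpr ⟨(Finset.mem_filter.mp hx).1, hlmax x hx⟩)⟩)
  linarith [hl.2]

/-- A Vitali covering argument which prefers small balls. -/
theorem exists_disjoint_balls (d : κ → κ → ℝ) (hself : ∀ i, d i i = 0)
    (hsymm : ∀ i j, d i j = d j i) (htri : ∀ i j l, d i l ≤ d i j + d j l) (V : Finset κ)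
    (r : κ → ℝ) (hr : ∀ i, 0 ≤ r i) (N : ℕ) : ∀ W : Finset κ, W.card ≤ N →
      ∃ P ⊆ W, (P : Set κ).PairwiseDisjoint (fun c => V.filter fun j => d c j ≤ r c) ∧
        ∀ i ∈ W, ∃ c ∈ P, d i c ≤ 2 * r i := by
  induction N with
  | zero =>
    intro W hW
    obtain rfl : W = ∅ := Finset.card_eq_zero.mp (by omega)
    exact ⟨∅, subset_rfl, by simp, by simp⟩
  | succ N ih =>
    intro W hW
    rcases W.eq_empty_or_nonempty with rfl | hne
    · exact ⟨∅, subset_rfl, by simp, by simp⟩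
    -- The smallest ball goes first: if the ball of `i` meets that of `c`, then `d i c ≤ r i + r c ≤
    -- 2 * r i`.
    obtain ⟨c, hc, hmin⟩ := W.exists_min_image r hne
    obtain ⟨P, hPW, hdisj, hcov⟩ := ih ((W.erase c).filter fun i =>
      Disjoint (V.filter fun j => d i j ≤ r i) (V.filter fun j => d c j ≤ r c)) (by
        have := Finset.card_filter_le (W.erase c) fun i =>
          Disjoint (V.filter fun j => d i j ≤ r i) (V.filter fun j => d c j ≤ r c)
        rw [Finset.card_erase_of_mem hc] at this
        omega)
    refine ⟨insert c P, ?_, ?_, ?_⟩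
    · refine Finset.insert_subset hc fun x hx => ?_
      exact Finset.mem_of_mem_erase (Finset.mem_filter.mp (hPW hx)).1
    · rw [Finset.coe_insert]
      refine hdisj.insert fun x hx _ => ?_
      exact (Finset.mem_filter.mp (hPW hx)).2.symm
    · intro i hi
      by_cases hic : i = c
      · subst hic
        exact ⟨i, Finset.mem_insert_self _ _, by rw [hself]; linarith [hr i]⟩
      by_cases hd : Disjoint (V.filter fun j => d i j ≤ r i) (V.filter fun j => d c j ≤ r c)
      · obtain ⟨c', hc', h⟩ := hcov i (Finset.mem_filter.mpr ⟨Finset.mem_erase.mpr ⟨hic, hi⟩, hd⟩)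
        exact ⟨c', Finset.mem_insert_of_mem hc', h⟩
      · rw [Finset.not_disjoint_iff] at hd
        obtain ⟨x, hx1, hx2⟩ := hd
        rw [Finset.mem_filter] at hx1 hx2
        refine ⟨c, Finset.mem_insert_self _ _, ?_⟩
        have h1 := htri i x c
        have h2 := hsymm x c
        linarith [hx1.2, hx2.2, hmin i hi]

/-- A large set contains a set of `s` points whose distances dominate their radii. -/
theorem exists_separated (d : κ → κ → ℝ) (hsymm : ∀ i j, d i j = d j i) (V : Finset κ)
    (r : κ → ℝ) {b : ℕ} (hb0 : 1 ≤ b) (hb : ∀ i, (V.filter fun j => d i j < r i).card < b)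
    (s : ℕ) : ∀ R ⊆ V, s * b ≤ R.card →
      ∃ K ⊆ R, K.card = s ∧ ∀ i ∈ K, ∀ j ∈ K, i ≠ j → r i ≤ d i j := by
  induction s with
  | zero => exact fun R _ _ => ⟨∅, by simp, by simp, by simp⟩
  | succ s ih =>
    intro R hR hcard
    rw [Nat.succ_mul] at hcard
    have hne : R.Nonempty := Finset.card_pos.mp (by omega)
    -- With the largest radius first, any `j` kept satisfies `r j ≤ r i ≤ d i j`. At most `b` points
    -- are discarded: fewer than `b` in the open ball, and `i` itself, which need not lie in it.
    obtain ⟨i, hi, hmax⟩ := R.exists_max_image r hne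
    have hsub : R ⊆ (R.filter fun j => j ≠ i ∧ r i ≤ d i j) ∪
        insert i (V.filter fun j => d i j < r i) := by
      intro j hj
      by_cases h1 : j = i
      · simp [h1]
      by_cases h2 : r i ≤ d i j
      · simp [h1, h2, hj]
      · simp [hR hj, not_le.mp h2]
    have h1 := (Finset.card_le_card hsub).trans (Finset.card_union_le _ _)
    have h2 := Finset.card_insert_le i (V.filter fun j => d i j < r i)
    have h3 := hb i
    obtain ⟨K, hKR, hK, hsep⟩ := ih (R.filter fun j => j ≠ i ∧ r i ≤ d i j)
      ((Finset.filter_subset _ _).trans hR) (by omega)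
    have hK' : ∀ j ∈ K, j ∈ R ∧ j ≠ i ∧ r i ≤ d i j := fun j hj => Finset.mem_filter.mp (hKR hj)
    refine ⟨insert i K, Finset.insert_subset hi fun j hj => (hK' j hj).1, ?_, ?_⟩
    · rw [Finset.card_insert_of_notMem fun h => (hK' i h).2.1 rfl, hK]
    · intro x hx y hy hxy
      rcases Finset.mem_insert.mp hx with rfl | hx
      · rcases Finset.mem_insert.mp hy with rfl | hy
        · exact absurd rfl hxy
        · exact (hK' y hy).2.2
      · rcases Finset.mem_insert.mp hy with hyi | hy
        · rw [hyi, hsymm]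
          exact (hmax x (hK' x hx).1).trans (hK' x hx).2.2
        · exact hsep x hx y hy hxy

/-- A sparse set of well separated pairs without large independent sets. -/
theorem exists_sparse_pairs (d : κ → κ → ℝ) (hsymm : ∀ i j, d i j = d j i) (V : Finset κ)
    (r : κ → ℝ) {b s : ℕ} (hs : 1 ≤ s) (hb0 : 1 ≤ b)
    (hb : ∀ i, (V.filter fun j => d i j < r i).card < b)
    (N : ℕ) : ∀ R ⊆ V, R.card ≤ N →
      ∃ H : Finset (κ × κ), H.card ≤ R.card * s ∧
        (∀ e ∈ H, e.1 ∈ R ∧ e.2 ∈ R ∧ r e.1 ≤ d e.1 e.2 ∧ r e.2 ≤ d e.1 e.2) ∧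
        ∀ W ⊆ R, (∀ e ∈ H, ¬ (e.1 ∈ W ∧ e.2 ∈ W)) → W.card * s ≤ R.card + s ^ 2 * b := by
  induction N with
  | zero =>
    intro R _ hRN
    obtain rfl : R = ∅ := Finset.card_eq_zero.mp (by omega)
    exact ⟨∅, by simp, by simp, fun W hW _ => by simp [Finset.subset_empty.mp hW]⟩
  | succ N ih =>
    intro R hR hRN
    by_cases hcard : s * b ≤ R.card
    · obtain ⟨K, hKR, hK, hsep⟩ := exists_separated d hsymm V r hb0 hb s R hR hcard
      have hRK : (R \ K).card = R.card - s := by rw [Finset.card_sdiff_of_subset hKR, hK]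
      have hsR : s ≤ R.card := hK ▸ Finset.card_le_card hKR
      obtain ⟨H, hH1, hH2, hH3⟩ := ih (R \ K) (Finset.sdiff_subset.trans hR) (by omega)
      refine ⟨H ∪ K.offDiag, ?_, ?_, ?_⟩
      · refine (Finset.card_union_le _ _).trans ?_
        rw [Finset.offDiag_card, hK]
        rw [hRK] at hH1
        obtain ⟨u, hu⟩ := Nat.exists_eq_add_of_le hsR
        rw [hu, Nat.add_sub_cancel_left] at hH1
        rw [hu, Nat.add_mul]
        omega
      · intro e he
        rcases Finset.mem_union.mp he with he | he
        · obtain ⟨h1, h2, h3⟩ := hH2 e he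
          exact ⟨(Finset.mem_sdiff.mp h1).1, (Finset.mem_sdiff.mp h2).1, h3⟩
        · obtain ⟨h1, h2, h3⟩ := Finset.mem_offDiag.mp he
          exact ⟨hKR h1, hKR h2, hsep _ h1 _ h2 h3,
            (hsep _ h2 _ h1 (Ne.symm h3)).trans_eq (hsymm _ _)⟩
      · intro W hW hind
        have h1 := hH3 (W \ K) (Finset.sdiff_subset_sdiff hW subset_rfl) fun e he hc =>
          hind e (Finset.mem_union_left _ he)
            ⟨(Finset.mem_sdiff.mp hc.1).1, (Finset.mem_sdiff.mp hc.2).1⟩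
        have h2 : (W ∩ K).card ≤ 1 := by
          refine Finset.card_le_one.mpr fun x hx y hy => ?_
          by_contra hxy
          rw [Finset.mem_inter] at hx hy
          exact hind (x, y) (Finset.mem_union_right _
            (Finset.mem_offDiag.mpr ⟨hx.2, hy.2, hxy⟩)) ⟨hx.1, hy.1⟩
        have h3 := Finset.card_sdiff_add_card_inter W K
        rw [hRK] at h1
        calc W.card * s = (W \ K).card * s + (W ∩ K).card * s := by rw [← h3, Nat.add_mul]
          _ ≤ (R.card - s + s ^ 2 * b) + 1 * s := Nat.add_le_add h1 (Nat.mul_le_mul_right _ h2)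
          _ = R.card + s ^ 2 * b := by omega
    · refine ⟨∅, by simp, by simp, fun W hW _ => ?_⟩
      have h1 := Finset.card_le_card hW
      calc W.card * s ≤ (s * b) * s := Nat.mul_le_mul_right _ (by omega)
        _ = s ^ 2 * b := by ring
        _ ≤ R.card + s ^ 2 * b := Nat.le_add_left _ _

/-- The comparisons of one round: few pairs `H` and few representatives `P` such that every pair of
`H` is at least half as far apart as its members are from `P`. -/
theorem exists_round (d : κ → κ → ℝ) (hself : ∀ i, d i i = 0) (hnn : ∀ i j, 0 ≤ d i j)
    (hsymm : ∀ i j, d i j = d j i) (htri : ∀ i j l, d i l ≤ d i j + d j l) (V : Finset κ) (s : ℕ)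
    (hs : 1 ≤ s) :
    ∃ PH : Finset κ × Finset (κ × κ), PH.1.card ≤ 2 * s ^ 2 ∧ PH.2.card ≤ V.card * s ∧
      (∀ e ∈ PH.2, (∃ c ∈ PH.1, d e.1 c ≤ 2 * d e.1 e.2) ∧
        ∃ c ∈ PH.1, d e.2 c ≤ 2 * d e.1 e.2) ∧
      ∀ W ⊆ V \ PH.1, (∀ e ∈ PH.2, ¬ (e.1 ∈ W ∧ e.2 ∈ W)) → W.card * s ≤ 2 * V.card := by
  -- A small `V` is put aside entirely, without any test.
  by_cases hVs : V.card < s ^ 2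
  · refine ⟨(V, ∅), by dsimp only; omega, by simp, by simp, fun W hW _ => ?_⟩
    simp only [sdiff_self, Finset.bot_eq_empty, Finset.subset_empty] at hW
    simp [hW]
  have hs2 : 0 < s ^ 2 := by positivity
  -- The largest `b` with `s ^ 2 * b ≤ V.card`; at most `2 * s ^ 2` disjoint balls of `b` points
  -- then fit into `V`.
  set b := V.card / s ^ 2 with hbdef
  have hb : 1 ≤ b := (Nat.one_le_div_iff hs2).mpr (not_lt.mp hVs)
  have hbV : s ^ 2 * b ≤ V.card := Nat.mul_div_le _ _
  have hVb : V.card < s ^ 2 * (b + 1) := Nat.lt_mul_div_succ _ hs2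
  choose r hr0 hr1 hr2 using exists_radius d hnn V hb (Nat.div_le_self _ _)
  obtain ⟨P, hPV, hdisj, hcov⟩ :=
    exists_disjoint_balls d hself hsymm htri V r hr0 V.card V le_rfl
  obtain ⟨H, hH1, hH2, hH3⟩ := exists_sparse_pairs d hsymm V r hs hb hr2 V.card V subset_rfl le_rfl
  refine ⟨(P, H), ?_, hH1, fun e he => ?_, fun W hW hind => ?_⟩
  · have h1 : P.card * b ≤ V.card := by
      calc P.card * b = ∑ c ∈ P, b := by simp
        _ ≤ ∑ c ∈ P, (V.filter fun j => d c j ≤ r c).card := Finset.sum_le_sum fun c _ => hr1 c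
        _ = (P.biUnion fun c => V.filter fun j => d c j ≤ r c).card :=
          (Finset.card_biUnion hdisj).symm
        _ ≤ V.card := Finset.card_le_card
          (Finset.biUnion_subset.mpr fun c _ => Finset.filter_subset _ _)
    have h2 : s ^ 2 * (b + 1) ≤ 2 * s ^ 2 * b := by nlinarith
    exact Nat.le_of_mul_le_mul_right ((h1.trans hVb.le).trans h2) hb
  · obtain ⟨h1, h2, h3, h4⟩ := hH2 e he
    obtain ⟨c, hc, hc'⟩ := hcov _ h1
    obtain ⟨c₂, hc₂, hc₂'⟩ := hcov _ h2
    exact ⟨⟨c, hc, by linarith⟩, ⟨c₂, hc₂, by linarith⟩⟩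
  · have := hH3 W (hW.trans Finset.sdiff_subset) hind
    omega

end Combinatorics

/-! ### Total variation distance -/

section TotalVariation

variable {𝒳 : Type*} [MeasurableSpace 𝒳]

theorem tvDist_bddAbove (p q : Measure 𝒳) [IsProbabilityMeasure p] [IsProbabilityMeasure q] :
    BddAbove (Set.range fun S : {S : Set 𝒳 // MeasurableSet S} => p.real S.1 - q.real S.1) := by
  refine ⟨1, ?_⟩
  rintro _ ⟨S, rfl⟩
  have h1 : p.real S.1 ≤ 1 := measureReal_le_one
  have h2 : 0 ≤ q.real S.1 := measureReal_nonneg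
  dsimp only
  linarith

theorem sub_le_tvDist (p q : Measure 𝒳) [IsProbabilityMeasure p] [IsProbabilityMeasure q]
    {S : Set 𝒳} (hS : MeasurableSet S) : p.real S - q.real S ≤ tvDist p q :=
  le_ciSup (tvDist_bddAbove p q) (⟨S, hS⟩ : {S : Set 𝒳 // MeasurableSet S})

theorem tvDist_le {p q : Measure 𝒳} {a : ℝ}
    (h : ∀ S, MeasurableSet S → p.real S - q.real S ≤ a) : tvDist p q ≤ a :=
  have : Nonempty {S : Set 𝒳 // MeasurableSet S} := ⟨⟨∅, MeasurableSet.empty⟩⟩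
  ciSup_le fun S => h S.1 S.2

theorem tvDist_nonneg (p q : Measure 𝒳) [IsProbabilityMeasure p] [IsProbabilityMeasure q] :
    0 ≤ tvDist p q := by
  simpa using sub_le_tvDist p q MeasurableSet.empty

theorem tvDist_le_one (p q : Measure 𝒳) [IsProbabilityMeasure p] : tvDist p q ≤ 1 := by
  refine tvDist_le fun S _ => ?_
  have h1 : p.real S ≤ 1 := measureReal_le_one
  have h2 : 0 ≤ q.real S := measureReal_nonneg
  linarith

theorem tvDist_self (p : Measure 𝒳) [IsProbabilityMeasure p] : tvDist p p = 0 :=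
  le_antisymm (tvDist_le fun S _ => by simp) (tvDist_nonneg p p)

theorem tvDist_comm (p q : Measure 𝒳) [IsProbabilityMeasure p] [IsProbabilityMeasure q] :
    tvDist p q = tvDist q p := by
  have key : ∀ p q : Measure 𝒳, IsProbabilityMeasure p → IsProbabilityMeasure q →
      tvDist p q ≤ tvDist q p := by
    intro p q _ _
    refine tvDist_le fun S hS => ?_
    have h := sub_le_tvDist q p hS.compl
    rw [probReal_compl_eq_one_sub hS, probReal_compl_eq_one_sub hS] at h
    linarith
  exact le_antisymm (key p q ‹_› ‹_›) (key q p ‹_› ‹_›)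

theorem tvDist_triangle (p q r : Measure 𝒳) [IsProbabilityMeasure p] [IsProbabilityMeasure q]
    [IsProbabilityMeasure r] : tvDist p r ≤ tvDist p q + tvDist q r :=
  tvDist_le fun S hS => by linarith [sub_le_tvDist p q hS, sub_le_tvDist q r hS]

theorem abs_sub_le_tvDist (p q : Measure 𝒳) [IsProbabilityMeasure p] [IsProbabilityMeasure q]
    {S : Set 𝒳} (hS : MeasurableSet S) : |p.real S - q.real S| ≤ tvDist p q :=
  abs_sub_le_iff.mpr ⟨sub_le_tvDist p q hS, tvDist_comm p q ▸ sub_le_tvDist q p hS⟩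

/-- Near-optimal Scheffé events suffice; the slack `τ` joins the estimation error. -/
theorem exists_tvDist_sub_le (p q : Measure 𝒳) {τ : ℝ} (hτ : 0 < τ) :
    ∃ S, MeasurableSet S ∧ tvDist p q - τ ≤ p.real S - q.real S := by
  have : Nonempty {S : Set 𝒳 // MeasurableSet S} := ⟨⟨∅, MeasurableSet.empty⟩⟩
  obtain ⟨S, hS⟩ := exists_lt_of_lt_ciSup
    (show tvDist p q - τ < ⨆ S : {S : Set 𝒳 // MeasurableSet S}, (p.real S.1 - q.real S.1) by
      rw [← tvDist]; linarith)
  exact ⟨S.1, S.2, hS.le⟩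

end TotalVariation

/-! ### Randomized response and its privacy -/

section RandomizedResponse

/-- The law of the coin of randomized response: the answer is flipped with probability
`1 / (1 + exp ε)`. -/
noncomputable def flipLaw (ε : ℝ) : Measure Bool :=
  ENNReal.ofReal (1 / (1 + Real.exp ε)) • Measure.dirac true +
    ENNReal.ofReal (Real.exp ε / (1 + Real.exp ε)) • Measure.dirac false

instance (ε : ℝ) : IsProbabilityMeasure (flipLaw ε) := by
  constructor
  have h := Real.exp_pos ε
  simp only [flipLaw, Measure.coe_add, Measure.coe_smul, Pi.add_apply, Pi.smul_apply,
    measure_univ, smul_eq_mul, mul_one]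
  rw [← ENNReal.ofReal_add (by positivity) (by positivity), ← add_div, div_self (by positivity),
    ENNReal.ofReal_one]

theorem flipLaw_real_true (ε : ℝ) : (flipLaw ε).real {true} = 1 / (1 + Real.exp ε) := by
  have h := Real.exp_pos ε
  simp [flipLaw, Measure.real, ENNReal.toReal_ofReal, h.le, add_nonneg]

theorem flipLaw_real_false (ε : ℝ) :
    (flipLaw ε).real {false} = Real.exp ε / (1 + Real.exp ε) := by
  have h := Real.exp_pos ε
  simp only [flipLaw, Measure.real, Measure.coe_add, Measure.coe_smul, Pi.add_apply,
    Pi.smul_apply, smul_eq_mul]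
  simp
  positivity

theorem flipLaw_real_le {ε : ℝ} (hε : 0 ≤ ε) (a b : Bool) :
    (flipLaw ε).real {a} ≤ Real.exp ε * (flipLaw ε).real {b} := by
  have h := Real.exp_pos ε
  have h1 : 1 ≤ Real.exp ε := Real.one_le_exp hε
  cases a <;> cases b <;> simp only [flipLaw_real_true, flipLaw_real_false] <;>
    rw [← mul_div_assoc] <;> gcongr <;> nlinarith

variable {𝒳 : Type*} [MeasurableSpace 𝒳] {n t : ℕ} {ι : Type*}

/-- The entries of `z` which are determined before round `q`. -/
def before (round : Fin n → Fin t) (q : Fin t) (z : Fin n → Bool) : Fin n → Bool :=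
  fun j => if round j < q then z j else false

open Classical in
theorem measurable_decide_mem {A : Set 𝒳} (hA : MeasurableSet A) :
    Measurable fun x => decide (x ∈ A) := by
  refine measurable_to_bool ?_
  simpa [Set.preimage] using hA

open Classical in
/-- Individual `i` speaks in round `round i` and answers by randomized response whether the own
data point lies in the set `S (ask (round i) z i)`, where `z` are the earlier answers. -/
noncomputable def responseProtocol (ε : ℝ) (S : ι → Set 𝒳) (hS : ∀ e, MeasurableSet (S e))
    (round : Fin n → Fin t) (ask : Fin t → (Fin n → Bool) → Fin n → ι) : Protocol 𝒳 n t where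
  Msg := Bool
  Coin := Bool
  coinLaw := flipLaw ε
  active q := Finset.univ.filter fun i => round i = q
  msg q i z := xor z.1 (decide (z.2.1 ∈ S (ask q (fun j => if hj : round j < q then
    z.2.2 ⟨round j, hj⟩ ⟨j, Finset.mem_filter.mpr ⟨Finset.mem_univ _, rfl⟩⟩ else false) i)))
  measurable_msg q i := by
    have h1 : Measurable fun z : 𝒳 × ((r : {r : Fin t // r < q}) →
        {j : Fin n // j ∈ Finset.univ.filter fun i => round i = r.1} → Bool) =>
        decide (z.1 ∈ S (ask q (fun j => if hj : round j < q then
          z.2 ⟨round j, hj⟩ ⟨j, Finset.mem_filter.mpr ⟨Finset.mem_univ _, rfl⟩⟩ else false) i)) := by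
      refine measurable_from_prod_countable_left fun h => ?_
      exact measurable_decide_mem (hS (ask q (fun j => if hj : round j < q then
        h ⟨round j, hj⟩ ⟨j, Finset.mem_filter.mpr ⟨Finset.mem_univ _, rfl⟩⟩ else false) i))
    exact (measurable_of_countable fun p : Bool × Bool => xor p.1 p.2).comp
      (measurable_fst.prodMk (h1.comp measurable_snd))

variable (ε : ℝ) (S : ι → Set 𝒳) (hS : ∀ e, MeasurableSet (S e)) (round : Fin n → Fin t)
  (ask : Fin t → (Fin n → Bool) → Fin n → ι)

/-- All answers of a transcript of `responseProtocol`, indexed by the individuals. -/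
def allBits (T : (responseProtocol ε S hS round ask).Transcript) : Fin n → Bool :=
  fun j => T (round j) ⟨j, Finset.mem_filter.mpr ⟨Finset.mem_univ _, rfl⟩⟩

theorem allBits_injective : Function.Injective (allBits ε S hS round ask) := by
  intro T T' h
  funext q i
  obtain ⟨i, hi⟩ := i
  obtain rfl : round i = q := (Finset.mem_filter.mp hi).2
  exact congrFun h i

open Classical in
theorem allBits_transcript (x : Fin n → 𝒳) (c : Fin t → Fin n → Bool) (i : Fin n) :
    allBits ε S hS round ask ((responseProtocol ε S hS round ask).transcript x c) i =
      xor (c (round i) i) (decide (x i ∈ S (ask (round i) (before round (round i)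
        (allBits ε S hS round ask ((responseProtocol ε S hS round ask).transcript x c))) i))) := by
  exact congrFun (Protocol.transcript.eq_1 (responseProtocol ε S hS round ask) x c (round i))
    ⟨i, Finset.mem_filter.mpr ⟨Finset.mem_univ _, rfl⟩⟩

-- A query depends on earlier rounds only, so data and coins determine the answers by recursion on
-- the round.
open Classical in
omit [MeasurableSpace 𝒳] in
theorem eq_of_forall_eq_xor (x : Fin n → 𝒳) (c : Fin t → Fin n → Bool) (z z' : Fin n → Bool)
    (hz : ∀ i, z i = xor (c (round i) i)
      (decide (x i ∈ S (ask (round i) (before round (round i) z) i))))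
    (hz' : ∀ i, z' i = xor (c (round i) i)
      (decide (x i ∈ S (ask (round i) (before round (round i) z') i)))) : z = z' := by
  have key : ∀ N : ℕ, ∀ i, (round i : ℕ) < N → z i = z' i := by
    intro N
    induction N with
    | zero => intro i hi; omega
    | succ N ih =>
      intro i hi
      have : before round (round i) z = before round (round i) z' := by
        funext j
        unfold before
        split_ifs with hj
        · exact ih j (by have : (round j : ℕ) < round i := hj; omega)
        · rfl
      rw [hz, hz', this]
  funext i
  exact key _ i (Nat.lt_succ_self _)

open Classical in
/-- The coins which on data `y` lead to the same transcript as the coins `c` on data `x`. -/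
noncomputable def recoin (x y : Fin n → 𝒳) (c : Fin t → Fin n → Bool) : Fin t → Fin n → Bool :=
  fun q i => if round i = q then
    xor (allBits ε S hS round ask ((responseProtocol ε S hS round ask).transcript x c) i)
      (decide (y i ∈ S (ask (round i) (before round (round i)
        (allBits ε S hS round ask ((responseProtocol ε S hS round ask).transcript x c))) i)))
  else c q i

theorem transcript_recoin (x y : Fin n → 𝒳) (c : Fin t → Fin n → Bool) :
    (responseProtocol ε S hS round ask).transcript y (recoin ε S hS round ask x y c) =
      (responseProtocol ε S hS round ask).transcript x c := by
  classical
  refine allBits_injective ε S hS round ask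
    (eq_of_forall_eq_xor S round ask y (recoin ε S hS round ask x y c) _ _
      (fun i => allBits_transcript ε S hS round ask y _ i) fun i => ?_)
  simp [recoin]

/-- Makes recoining a bijection, which reduces privacy to comparing the masses of single coin
arrays. -/
theorem recoin_recoin (x y : Fin n → 𝒳) (c : Fin t → Fin n → Bool) :
    recoin ε S hS round ask y x (recoin ε S hS round ask x y c) = c := by
  classical
  funext q i
  by_cases hq : round i = q
  · subst hq
    rw [recoin, if_pos rfl, transcript_recoin, allBits_transcript]
    simp
  · simp [recoin, hq]

theorem recoin_eq_of_eq (x y : Fin n → 𝒳) (c : Fin t → Fin n → Bool) (q : Fin t) (i : Fin n)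
    (h : x i = y i ∨ round i ≠ q) : recoin ε S hS round ask x y c q i = c q i := by
  classical
  by_cases hq : round i = q
  · subst hq
    have hx : x i = y i := h.resolve_right (by simp)
    rw [recoin, if_pos rfl, allBits_transcript, ← hx]
    simp
  · simp [recoin, hq]

theorem coins_real_singleton (c : Fin t → Fin n → Bool) :
    (responseProtocol ε S hS round ask).coins.real ({c} : Set (Fin t → Fin n → Bool)) =
      ∏ q, ∏ i, (flipLaw ε).real {c q i} := by
  suffices h : (Measure.pi fun _ : Fin t => Measure.pi fun _ : Fin n => flipLaw ε).real {c} =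
      ∏ q, ∏ i, (flipLaw ε).real {c q i} from h
  rw [measureReal_def, Measure.pi_singleton, ENNReal.toReal_prod]
  refine Finset.prod_congr rfl fun q _ => ?_
  rw [Measure.pi_singleton, ENNReal.toReal_prod]
  rfl

theorem coins_real_singleton_le (hε : 0 ≤ ε) (x y : Fin n → 𝒳) (i₀ : Fin n)
    (hxy : ∀ j, j ≠ i₀ → x j = y j) (c : Fin t → Fin n → Bool) :
    (responseProtocol ε S hS round ask).coins.real ({c} : Set (Fin t → Fin n → Bool)) ≤
      Real.exp ε * (responseProtocol ε S hS round ask).coins.real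
        ({recoin ε S hS round ask x y c} : Set (Fin t → Fin n → Bool)) := by
  classical
  rw [coins_real_singleton, coins_real_singleton]
  -- Only the coin that `i₀` uses in its own round can change, so only one factor `exp ε` arises.
  calc ∏ q, ∏ i, (flipLaw ε).real {c q i}
      ≤ ∏ q, ∏ i, ((if round i₀ = q then if i₀ = i then Real.exp ε else 1 else 1) *
          (flipLaw ε).real {recoin ε S hS round ask x y c q i}) := by
        refine Finset.prod_le_prod (fun q _ => Finset.prod_nonneg fun i _ => measureReal_nonneg)
          fun q _ => Finset.prod_le_prod (fun i _ => measureReal_nonneg) fun i _ => ?_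
        split_ifs with h1 h2
        · exact flipLaw_real_le hε _ _
        · rw [recoin_eq_of_eq ε S hS round ask x y c q i (Or.inl (hxy i (Ne.symm h2))), one_mul]
        · rw [one_mul, recoin_eq_of_eq]
          by_cases h : i = i₀
          · exact Or.inr (h ▸ h1)
          · exact Or.inl (hxy i h)
    _ = Real.exp ε * ∏ q, ∏ i, (flipLaw ε).real {recoin ε S hS round ask x y c q i} := by
        simp only [Finset.prod_mul_distrib]
        congr 1
        rw [Finset.prod_eq_single (round i₀) (fun q _ hq => by simp [Ne.symm hq]) (by simp)]
        simp

theorem responseProtocol_isLDP (hε : 0 ≤ ε) : (responseProtocol ε S hS round ask).IsLDP ε := by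
  classical
  rintro x y ⟨i₀, hxy⟩ A _
  have key : ∀ x : Fin n → 𝒳, (responseProtocol ε S hS round ask).coins.real
      {c | (responseProtocol ε S hS round ask).transcript x c ∈ A} =
      ∑ c ∈ Finset.univ.filter fun c : Fin t → Fin n → Bool =>
        (responseProtocol ε S hS round ask).transcript x c ∈ A,
        (responseProtocol ε S hS round ask).coins.real ({c} : Set (Fin t → Fin n → Bool)) := by
    intro x
    have := sum_measureReal_singleton (μ := Measure.pi fun _ : Fin t => Measure.pi fun _ : Fin n =>
      flipLaw ε) (Finset.univ.filter fun c : Fin t → Fin n → Bool =>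
        (responseProtocol ε S hS round ask).transcript x c ∈ A)
    rw [Finset.coe_filter] at this
    simp only [Finset.mem_univ, true_and] at this
    exact this.symm
  rw [key, key, Finset.mul_sum]
  calc _ ≤ ∑ c ∈ Finset.univ.filter fun c : Fin t → Fin n → Bool =>
        (responseProtocol ε S hS round ask).transcript x c ∈ A, Real.exp ε *
        (responseProtocol ε S hS round ask).coins.real
          ({recoin ε S hS round ask x y c} : Set (Fin t → Fin n → Bool)) :=
        Finset.sum_le_sum fun c _ => coins_real_singleton_le ε S hS round ask hε x y i₀ hxy c
    _ = _ := by
        refine Finset.sum_bij' (fun c _ => recoin ε S hS round ask x y c)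
          (fun c _ => recoin ε S hS round ask y x c) ?_ ?_ ?_ ?_ ?_
        · intro c hc
          simp only [Finset.mem_filter, Finset.mem_univ, true_and] at hc ⊢
          rwa [transcript_recoin]
        · intro c hc
          simp only [Finset.mem_filter, Finset.mem_univ, true_and] at hc ⊢
          rwa [transcript_recoin]
        · intro c _
          exact recoin_recoin ε S hS round ask x y c
        · intro c _
          exact recoin_recoin ε S hS round ask y x c
        · intro c _
          rfl

theorem responseProtocol_isSequentiallyInteractive :
    (responseProtocol ε S hS round ask).IsSequentiallyInteractive := by
  intro q r hqr
  refine Finset.disjoint_left.mpr fun i hi hi' => hqr ?_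
  rw [← (Finset.mem_filter.mp hi).2, ← (Finset.mem_filter.mp hi').2]

end RandomizedResponse

/-! ### Concentration of the debiased answers -/

section Concentration

open ProbabilityTheory

/-- Hoeffding's inequality for the average of `m` independent variables with values in `[0, 1]`. -/
theorem measureReal_abs_average_sub_gt_le {Ω : Type*} [MeasurableSpace Ω] {μ : Measure Ω}
    [IsProbabilityMeasure μ] {m : ℕ} (hm : 0 < m) {Y : Fin m → Ω → ℝ} (hind : iIndepFun Y μ)
    (hmeas : ∀ i, Measurable (Y i)) (h01 : ∀ i ω, Y i ω ∈ Set.Icc (0 : ℝ) 1) {v : ℝ}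
    (hv : ∀ i, ∫ ω, Y i ω ∂μ = v) {δ : ℝ} (hδ : 0 ≤ δ) :
    μ.real {ω | δ < |(∑ i, Y i ω) / m - v|} ≤ 2 * Real.exp (-(2 * m * δ ^ 2)) := by
  have hm' : (0 : ℝ) < m := by exact_mod_cast hm
  have hsub : ∀ i, HasSubgaussianMGF (fun ω => Y i ω - v) ((‖(1 : ℝ) - 0‖₊ / 2) ^ 2) μ := by
    intro i
    have := hasSubgaussianMGF_of_mem_Icc (hmeas i).aemeasurable (ae_of_all μ (h01 i))
    rwa [hv] at this
  -- Each variable has variance proxy 1/4, so the exponent is `-(m * δ) ^ 2 / (2 * (m / 4))`.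
  have hexp : -(m * δ) ^ 2 / (2 * ((∑ _i : Fin m, ((‖(1 : ℝ) - 0‖₊ / 2) ^ 2) : NNReal) : ℝ)) =
      -(2 * m * δ ^ 2) := by
    simp
    field_simp
  have hup := HasSubgaussianMGF.measure_sum_ge_le_of_iIndepFun
    (hind.comp (fun _ y => y - v) fun _ => measurable_id.sub_const v)
    (s := Finset.univ) (fun i _ => hsub i) (ε := m * δ) (by positivity)
  have hlo := HasSubgaussianMGF.measure_sum_ge_le_of_iIndepFun
    (hind.comp (fun _ y => -(y - v)) fun _ => (measurable_id.sub_const v).neg)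
    (s := Finset.univ) (fun i _ => (hsub i).neg) (ε := m * δ) (by positivity)
  rw [hexp] at hup hlo
  calc μ.real {ω | δ < |(∑ i, Y i ω) / m - v|}
      ≤ μ.real ({ω | m * δ ≤ ∑ i, ((fun y => y - v) ∘ Y i) ω} ∪
          {ω | m * δ ≤ ∑ i, ((fun y => -(y - v)) ∘ Y i) ω}) := by
        refine measureReal_mono fun ω hω => ?_
        simp only [Set.mem_ofPred_eq, Set.mem_union, Function.comp_apply, Finset.sum_neg_distrib,
          Finset.sum_sub_distrib, Finset.sum_const, Finset.card_univ, Fintype.card_fin,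
          nsmul_eq_mul] at hω ⊢
        have h : (∑ i, Y i ω) - m * v = m * ((∑ i, Y i ω) / m - v) := by field_simp
        rw [h]
        rcases lt_abs.mp hω with h | h
        · left; nlinarith
        · right; nlinarith
    _ ≤ _ := measureReal_union_le _ _
    _ ≤ 2 * Real.exp (-(2 * m * δ ^ 2)) := by linarith

variable {𝒳 : Type*} [MeasurableSpace 𝒳] {n t : ℕ}

/-- Every individual uses a single coin, so that the pairs of data points and coins are i.i.d. -/
theorem measurePreserving_dataCoin (p : Measure 𝒳) [IsProbabilityMeasure p] {Γ : Type*}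
    [MeasurableSpace Γ] (ν : Measure Γ) [IsProbabilityMeasure ν] (round : Fin n → Fin t) :
    MeasurePreserving (fun (xc : (Fin n → 𝒳) × (Fin t → Fin n → Γ)) (j : Fin n) =>
        (xc.1 j, xc.2 (round j) j))
      ((Measure.pi fun _ => p).prod (Measure.pi fun _ => Measure.pi fun _ => ν))
      (Measure.pi fun _ => p.prod ν) := by
  have h1 : MeasurePreserving (fun (c : Fin t → Fin n → Γ) (j : Fin n) => c (round j) j)
      (Measure.pi fun _ => Measure.pi fun _ => ν) (Measure.pi fun _ => ν) := by
    have hmeas : Measurable fun (c : Fin t → Fin n → Γ) (j : Fin n) => c (round j) j := by fun_prop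
    refine ⟨hmeas, (Measure.pi_eq fun s hs => ?_).symm⟩
    rw [Measure.map_apply hmeas (MeasurableSet.univ_pi hs)]
    -- The preimage of a box is a box that constrains only the coordinates `(round i, i)`.
    have : (fun (c : Fin t → Fin n → Γ) (j : Fin n) => c (round j) j) ⁻¹' Set.univ.pi s =
        Set.univ.pi fun q => Set.univ.pi fun i => if round i = q then s i else Set.univ := by
      ext c
      simp only [Set.mem_preimage, Set.mem_univ_pi]
      refine ⟨fun h q i => ?_, fun h j => by simpa using h (round j) j⟩
      split_ifs with hq
      · exact hq ▸ h i
      · trivial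
    rw [this, Measure.pi_pi]
    simp only [Measure.pi_pi]
    rw [Finset.prod_comm]
    refine Finset.prod_congr rfl fun i _ => ?_
    rw [Finset.prod_eq_single (round i) (fun q _ hq => by simp [Ne.symm hq]) (by simp)]
    simp
  have h2 := (measurePreserving_arrowProdEquivProdArrow 𝒳 Γ (Fin n) (fun _ => p) fun _ => ν).symm
  exact h2.comp ((MeasurePreserving.id _).prod h1)

-- The answer is positive for an unflipped point of `A` or a flipped point outside, so its mean is
-- affine in the probability of `A`; `debias` inverts this affine map.
open Classical in
theorem integral_response (ε : ℝ) (p : Measure 𝒳) [IsProbabilityMeasure p] {A : Set 𝒳}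
    (hA : MeasurableSet A) :
    ∫ y : 𝒳 × Bool, (if xor y.2 (decide (y.1 ∈ A)) then (1 : ℝ) else 0) ∂(p.prod (flipLaw ε)) =
      1 / (1 + Real.exp ε) + (Real.exp ε - 1) / (Real.exp ε + 1) * p.real A := by
  have h : (fun y : 𝒳 × Bool => if xor y.2 (decide (y.1 ∈ A)) then (1 : ℝ) else 0) =
      Set.indicator (A ×ˢ {false} ∪ Aᶜ ×ˢ {true}) 1 := by
    funext y
    obtain ⟨x, c⟩ := y
    by_cases hx : x ∈ A <;> cases c <;> simp [hx, Set.indicator]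
  have hm1 : MeasurableSet (A ×ˢ ({false} : Set Bool)) := hA.prod (measurableSet_singleton _)
  have hm2 : MeasurableSet (Aᶜ ×ˢ ({true} : Set Bool)) := hA.compl.prod (measurableSet_singleton _)
  rw [h, integral_indicator_one (hm1.union hm2), measureReal_union _ hm2, measureReal_prod_prod,
    measureReal_prod_prod, probReal_compl_eq_one_sub hA, flipLaw_real_true, flipLaw_real_false]
  · have := Real.exp_pos ε
    field_simp
    ring
  · refine Set.disjoint_left.mpr ?_
    rintro ⟨x, c⟩ h1 h2
    exact h2.1 h1.1

/-- The debiased average of the answers `z` of `m` individuals. -/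
noncomputable def debias (ε : ℝ) {m : ℕ} (z : Fin m → Bool) : ℝ :=
  ((∑ i, if z i then (1 : ℝ) else 0) / m - 1 / (1 + Real.exp ε)) /
    ((Real.exp ε - 1) / (Real.exp ε + 1))

open Classical in
theorem measureReal_debias_gt_le {ε : ℝ} (hε : 0 < ε) (p : Measure 𝒳) [IsProbabilityMeasure p]
    {A : Set 𝒳} (hA : MeasurableSet A) {m : ℕ} (hm : 0 < m) (idx : Fin m → Fin n)
    (hidx : Function.Injective idx) {τ : ℝ} (hτ : 0 ≤ τ) :
    (Measure.pi fun _ : Fin n => p.prod (flipLaw ε)).real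
      {w | τ < |debias ε (fun i => xor (w (idx i)).2 (decide ((w (idx i)).1 ∈ A))) - p.real A|} ≤
      2 * Real.exp (-(2 * m * ((Real.exp ε - 1) / (Real.exp ε + 1) * τ) ^ 2)) := by
  set g : 𝒳 × Bool → ℝ := fun y => if xor y.2 (decide (y.1 ∈ A)) then (1 : ℝ) else 0 with hg
  have hgm : Measurable g := by
    have h1 : Measurable fun y : 𝒳 × Bool => decide (y.1 ∈ A) :=
      (measurable_decide_mem hA).comp measurable_fst
    exact (measurable_of_countable fun b : Bool × Bool =>
      if xor b.1 b.2 then (1 : ℝ) else 0).comp (measurable_snd.prodMk h1)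
  have hind := (iIndepFun_pi (μ := fun _ : Fin n => p.prod (flipLaw ε)) (X := fun _ => g)
    fun _ => hgm.aemeasurable).precomp hidx
  have hpos : 0 < (Real.exp ε - 1) / (Real.exp ε + 1) := by
    have := Real.add_one_lt_exp hε.ne'
    exact div_pos (by linarith) (by linarith)
  refine le_trans (measureReal_mono fun w hw => ?_)
    (measureReal_abs_average_sub_gt_le hm hind (fun i => hgm.comp (measurable_pi_apply _))
      (fun i ω => ?_) (v := 1 / (1 + Real.exp ε) + (Real.exp ε - 1) / (Real.exp ε + 1) * p.real A)
      (fun i => ?_) (mul_nonneg hpos.le hτ))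
  · simp only [Set.mem_ofPred_eq] at hw ⊢
    have h : debias ε (fun i => xor (w (idx i)).2 (decide ((w (idx i)).1 ∈ A))) - p.real A =
        ((∑ i, g (w (idx i))) / m - (1 / (1 + Real.exp ε) +
          (Real.exp ε - 1) / (Real.exp ε + 1) * p.real A)) /
          ((Real.exp ε - 1) / (Real.exp ε + 1)) := by
      rw [debias]
      rw [← sub_sub, sub_div _ (_ * _), mul_div_cancel_left₀ _ hpos.ne']
    rw [h, abs_div, abs_of_pos hpos, lt_div_iff₀ hpos, mul_comm] at hw
    exact hw
  · simp only [hg]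
    split_ifs <;> simp
  · rw [← integral_response ε p hA]
    have hmp := measurePreserving_eval (fun _ : Fin n => p.prod (flipLaw ε)) (idx i)
    have h := integral_map hmp.aemeasurable (f := g) hgm.aestronglyMeasurable
    rw [hmp.map_eq] at h
    exact h.symm

end Concentration

/-! ### Simulating adaptive queries by a private protocol -/

section Simulation

/-- The states of an interactive algorithm when its queries are answered by `a`. -/
def run {σ α : Type*} (init : σ) (next : ℕ → σ → α → σ) (a : ℕ → α) : ℕ → σ
  | 0 => init
  | q + 1 => next q (run init next a q) (a q)

theorem run_congr {σ α : Type*} (init : σ) (next : ℕ → σ → α → σ) {a a' : ℕ → α} :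
    ∀ {q : ℕ}, (∀ r < q, a r = a' r) → run init next a q = run init next a' q
  | 0, _ => rfl
  | q + 1, h => by
    rw [run, run, run_congr init next fun r hr => h r (hr.trans (Nat.lt_succ_self q)),
      h q (Nat.lt_succ_self q)]

variable {t M m : ℕ}

/-- The `i`-th individual of the group which answers query `b` of round `q`. -/
def member (q : Fin t) (b : Fin M) (i : Fin m) : Fin (t * M * m) :=
  finProdFinEquiv (finProdFinEquiv (q, b), i)

/-- The round and the number of the query that an individual answers. -/
def assignment (j : Fin (t * M * m)) : Fin t × Fin M :=
  finProdFinEquiv.symm (finProdFinEquiv.symm j).1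

theorem assignment_member (q : Fin t) (b : Fin M) (i : Fin m) :
    assignment (member q b i) = (q, b) := by
  simp [assignment, member]

theorem member_injective (q : Fin t) (b : Fin M) :
    Function.Injective (member q b : Fin m → Fin (t * M * m)) := by
  intro i j h
  simpa [member] using h

/-- The estimates which are computed from the answers of all individuals. -/
noncomputable def estimates (ε : ℝ) (z : Fin (t * M * m) → Bool) (q : ℕ) (b : Fin M) : ℝ :=
  if hq : q < t then debias ε fun i => z (member ⟨q, hq⟩ b i) else 0

/-- An individual of round `q` sees later answers as `false`, yet recovers the true earlier
estimates and hence the query to answer. -/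
theorem estimates_before (ε : ℝ) (z : Fin (t * M * m) → Bool) (q : Fin t) {r : ℕ} (hr : r < q) :
    estimates ε (before (fun j => (assignment j).1) q z) r = estimates ε z r := by
  funext b
  unfold estimates before
  simp only [assignment_member]
  split_ifs with hrt h
  · rfl
  · exact absurd hr h
  · rfl

variable {𝒳 : Type*} [MeasurableSpace 𝒳]

/-- An interactive algorithm which asks `M` queries for probabilities per round can be implemented
by a sequentially interactive, locally private protocol. -/
theorem exists_protocol {ι σ κ : Type*} [Fintype ι] [MeasurableSpace κ] {ε τ : ℝ} (hε : 0 < ε)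
    (hτ : 0 < τ) (t M m : ℕ) (hm : 0 < m)
    (hbound : (Fintype.card ι * (t * M) : ℝ) *
      (2 * Real.exp (-(2 * m * ((Real.exp ε - 1) / (Real.exp ε + 1) * τ) ^ 2))) ≤ 1 / 10)
    (S : ι → Set 𝒳) (hS : ∀ e, MeasurableSet (S e)) (init : σ) (ask : ℕ → σ → Fin M → ι)
    (next : ℕ → σ → (Fin M → ℝ) → σ) (out : σ → κ) :
    ∃ P : Protocol 𝒳 (t * M * m) t, P.IsSequentiallyInteractive ∧ P.IsLDP ε ∧
      ∃ output : P.Transcript → κ, Measurable output ∧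
        ∀ p : Measure 𝒳, IsProbabilityMeasure p → 9 / 10 ≤ (P.experiment p).real
          {xc | ∃ a : ℕ → Fin M → ℝ,
            (∀ q < t, ∀ b, |a q b - p.real (S (ask q (run init next a q) b))| ≤ τ) ∧
            output (P.transcript xc.1 xc.2) = out (run init next a t)} := by
  classical
  set rd : Fin (t * M * m) → Fin t := fun j => (assignment j).1 with hrd
  set ask' : Fin t → (Fin (t * M * m) → Bool) → Fin (t * M * m) → ι := fun q z j =>
    ask q (run init next (estimates ε z) q) (assignment j).2 with hask
  refine ⟨responseProtocol ε S hS rd ask', responseProtocol_isSequentiallyInteractive ε S hS rd ask',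
    responseProtocol_isLDP ε S hS rd ask' hε.le,
    fun T => out (run init next (estimates ε (allBits ε S hS rd ask' T)) t), ?_, ?_⟩
  · have : Finite (responseProtocol ε S hS rd ask').Transcript :=
      inferInstanceAs (Finite ((q : Fin t) → {i // i ∈ Finset.univ.filter fun i => rd i = q} → Bool))
    have : MeasurableSingletonClass (responseProtocol ε S hS rd ask').Transcript :=
      inferInstanceAs (MeasurableSingletonClass
        ((q : Fin t) → {i // i ∈ Finset.univ.filter fun i => rd i = q} → Bool))
    exact measurable_of_finite _
  intro p _
  -- The event asked in a slot is random. Failure is therefore defined for each fixed event, as if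
  -- the group had been asked about it, and the union bound covers all events and slots.
  set B : ι × Fin t × Fin M → Set (Fin (t * M * m) → 𝒳 × Bool) := fun eqb =>
    {w | τ < |debias ε (fun i => xor (w (member eqb.2.1 eqb.2.2 i)).2
      (decide ((w (member eqb.2.1 eqb.2.2 i)).1 ∈ S eqb.1))) - p.real (S eqb.1)|} with hB
  have hBreal : (Measure.pi fun _ : Fin (t * M * m) => p.prod (flipLaw ε)).real (⋃ u, B u) ≤
      1 / 10 := by
    refine (measureReal_iUnion_fintype_le _).trans (le_trans (Finset.sum_le_sum fun u _ =>
      measureReal_debias_gt_le hε p (hS u.1) hm _ (member_injective u.2.1 u.2.2) hτ.le) ?_)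
    simpa using hbound
  have hBmeas : MeasurableSet (⋃ u, B u) := by
    refine MeasurableSet.iUnion fun u => ?_
    have h1 : ∀ i : Fin m, Measurable fun w : Fin (t * M * m) → 𝒳 × Bool =>
        xor (w (member u.2.1 u.2.2 i)).2 (decide ((w (member u.2.1 u.2.2 i)).1 ∈ S u.1)) :=
      fun i => (measurable_of_countable fun b : Bool × Bool => xor b.1 b.2).comp
        ((measurable_snd.comp (measurable_pi_apply _)).prodMk
          ((measurable_decide_mem (hS u.1)).comp (measurable_fst.comp (measurable_pi_apply _))))
    exact measurableSet_lt measurable_const ((((measurable_of_finite (debias ε)).comp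
      (measurable_pi_lambda _ h1)).sub_const _).abs)
  have hmp := measurePreserving_dataCoin p (flipLaw ε) rd
  have hgood : 9 / 10 ≤ ((responseProtocol ε S hS rd ask').experiment p).real
      ((fun (xc : (Fin (t * M * m) → 𝒳) × (Fin t → Fin (t * M * m) → Bool)) j =>
        (xc.1 j, xc.2 (rd j) j)) ⁻¹' (⋃ u, B u)ᶜ) := by
    have h1 : ((responseProtocol ε S hS rd ask').experiment p).real
      ((fun (xc : (Fin (t * M * m) → 𝒳) × (Fin t → Fin (t * M * m) → Bool)) j =>
        (xc.1 j, xc.2 (rd j) j)) ⁻¹' (⋃ u, B u)ᶜ) =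
      (Measure.pi fun _ : Fin (t * M * m) => p.prod (flipLaw ε)).real (⋃ u, B u)ᶜ :=
      congrArg ENNReal.toReal (hmp.measure_preimage hBmeas.compl.nullMeasurableSet)
    rw [h1, probReal_compl_eq_one_sub hBmeas]
    linarith
  refine hgood.trans ?_
  have hfin : IsProbabilityMeasure ((responseProtocol ε S hS rd ask').experiment p) :=
    inferInstanceAs (IsProbabilityMeasure ((Measure.pi fun _ : Fin (t * M * m) => p).prod
      (Measure.pi fun _ : Fin t => Measure.pi fun _ : Fin (t * M * m) => flipLaw ε)))
  refine measureReal_mono ?_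
  rintro ⟨x, c⟩ hxc
  set z := allBits ε S hS rd ask' ((responseProtocol ε S hS rd ask').transcript x c) with hz
  refine ⟨estimates ε z, fun q hq b => ?_, rfl⟩
  have h2 : (fun j => (x j, c (rd j) j)) ∉
      B (ask q (run init next (estimates ε z) q) b, ⟨q, hq⟩, b) := fun h =>
    hxc (Set.mem_iUnion.mpr ⟨_, h⟩)
  have h2' : |debias ε (fun i => xor (c (rd (member ⟨q, hq⟩ b i)) (member ⟨q, hq⟩ b i))
      (decide (x (member ⟨q, hq⟩ b i) ∈ S (ask q (run init next (estimates ε z) q) b)))) -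
      p.real (S (ask q (run init next (estimates ε z) q) b))| ≤ τ := not_lt.mp h2
  have h3 : estimates ε z q b = debias ε fun i => z (member ⟨q, hq⟩ b i) := dif_pos hq
  rw [h3]
  convert h2' using 4
  funext i
  have h4 := allBits_transcript ε S hS rd ask' x c (member ⟨q, hq⟩ b i)
  rw [← hz] at h4
  have h5 : rd (member ⟨q, hq⟩ b i) = ⟨q, hq⟩ := congrArg Prod.fst (assignment_member _ _ _)
  have h6 : ask' (rd (member ⟨q, hq⟩ b i)) (before rd (rd (member ⟨q, hq⟩ b i)) z)
      (member ⟨q, hq⟩ b i) = ask q (run init next (estimates ε z) q) b := by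
    rw [h5]
    simp only [hask, assignment_member]
    rw [run_congr init next fun r hr => estimates_before ε z ⟨q, hq⟩ hr]
  rw [h4, h6]

end Simulation

/-! ### Scheffé tests and the selection algorithm -/

section Selection

variable {κ : Type*} {M : ℕ}

/-- The loser of a Scheffé test: `w i e` is the probability of the `e`-th event under the `i`-th
hypothesis, and `y` is an estimate of its true probability. -/
noncomputable def loser (w : κ → κ × κ → ℝ) (e : κ × κ) (y : ℝ) : κ :=
  if |y - w e.2 e| ≤ |y - w e.1 e| then e.1 else e.2

open Classical in
/-- The largest error of hypothesis `i` in its tests against the members of `G`. -/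
noncomputable def score (w : κ → κ × κ → ℝ) (G : Finset κ) (query : Fin M → κ × κ) (a : Fin M → ℝ)
    (i : κ) : ℝ :=
  ⨆ b : Fin M, if query b ∈ G ×ˢ G ∧ (query b).1 = i then |a b - w i (query b)| else 0

open Classical in
/-- The minimum distance estimate in `G`. -/
noncomputable def minDistance (w : κ → κ × κ → ℝ) (G : Finset κ) (query : Fin M → κ × κ)
    (a : Fin M → ℝ) (default : κ) : κ :=
  if hG : G.Nonempty then (G.exists_min_image (score w G query a) hG).choose else default

/-- For the minimizer `i`, `D i ≤ D c + d i c`, and the event of `(i, c)` bounds `d i c` by `(w i -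
a) + (a - v) + (v - w c) + τ`. These differences are at most `D c + τ` (the score of `c`), `τ` and
`D c`. -/
theorem minDistance_le {w : κ → κ × κ → ℝ} {d : κ → κ → ℝ} {D : κ → ℝ} {v : κ × κ → ℝ} {τ : ℝ}
    (hτ : 0 ≤ τ) (hD : ∀ i, 0 ≤ D i) (hvw : ∀ i e, |v e - w i e| ≤ D i)
    (hw : ∀ i j, d i j - τ ≤ w i (i, j) - w j (i, j)) (hDd : ∀ i j, D i ≤ D j + d i j)
    {G : Finset κ} {query : Fin M → κ × κ} (hq : ∀ e ∈ G ×ˢ G, ∃ b, query b = e) {a : Fin M → ℝ}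
    (ha : ∀ b, |a b - v (query b)| ≤ τ) {c : κ} (hc : c ∈ G) (i₀ : κ) :
    D (minDistance w G query a i₀) ≤ 3 * D c + 3 * τ := by
  classical
  have hG : G.Nonempty := ⟨c, hc⟩
  set i := minDistance w G query a i₀ with hi
  have hspec : i ∈ G ∧ ∀ j ∈ G, score w G query a i ≤ score w G query a j := by
    rw [hi, minDistance, dif_pos hG]
    exact (G.exists_min_image (score w G query a) hG).choose_spec
  have h1 : score w G query a c ≤ D c + τ := by
    refine Real.iSup_le (fun b => ?_) (add_nonneg (hD c) hτ)
    split_ifs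
    · have h2 := abs_sub_le (a b) (v (query b)) (w c (query b))
      linarith [ha b, hvw c (query b)]
    · exact add_nonneg (hD c) hτ
  obtain ⟨b, hb⟩ := hq (i, c) (Finset.mk_mem_product hspec.1 hc)
  have h3 : |a b - w i (i, c)| ≤ score w G query a i := by
    refine le_trans ?_ (le_ciSup (Set.finite_range _).bddAbove b)
    rw [if_pos ⟨hb ▸ Finset.mk_mem_product hspec.1 hc, by rw [hb]⟩, hb]
  have h4 := hspec.2 c hc
  have h5 := ha b
  rw [hb] at h5
  have h6 := hvw c (i, c)
  rw [abs_le] at h3 h5 h6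
  linarith [hw i c, hDd i c]

/-- The estimate misses the loser's prediction by at most `D + τ` and the winner's by no more, so
the two differ by at most `2 * D + 2 * τ`; the third `τ` is the deficit of the event. -/
theorem dist_loser_le {w : κ → κ × κ → ℝ} {d : κ → κ → ℝ} {D : κ → ℝ} {v : κ × κ → ℝ} {τ : ℝ}
    (hvw : ∀ i e, |v e - w i e| ≤ D i) (hw : ∀ i j, d i j - τ ≤ w i (i, j) - w j (i, j))
    {e : κ × κ} {y : ℝ} (hy : |y - v e| ≤ τ) :
    d e.1 e.2 ≤ 2 * D (loser w e y) + 3 * τ := by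
  have h1 := hvw e.1 e
  have h2 := hvw e.2 e
  have h3 := hw e.1 e.2
  unfold loser
  split_ifs with h
  · have h4 := abs_sub_le y (v e) (w e.1 e)
    have h5 := h.trans (h4.trans (add_le_add hy h1))
    rw [abs_le] at hy h1 h5
    change d e.1 e.2 - τ ≤ w e.1 e - w e.2 e at h3
    linarith
  · have h4 := abs_sub_le y (v e) (w e.2 e)
    have h5 := (not_le.mp h).le.trans (h4.trans (add_le_add hy h2))
    rw [abs_le] at hy h2 h5
    change d e.1 e.2 - τ ≤ w e.1 e - w e.2 e at h3
    linarith

variable [DecidableEq κ] [Fintype κ]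

open Classical in
/-- The candidates which remain when the losers of the tests `H` and the representatives `P` have
been removed. -/
noncomputable def survivors (w : κ → κ × κ → ℝ) (V : Finset κ)
    (PH : Finset κ × Finset (κ × κ)) (query : Fin M → κ × κ) (a : Fin M → ℝ) : Finset κ :=
  (V \ PH.1).filter fun i => ∀ b, query b ∈ PH.2 → loser w (query b) (a b) ≠ i

/-- One round of the selection algorithm. A state consists of the remaining candidates, the
representatives which have been put aside, and the output. -/
noncomputable def selectionStep (w : κ → κ × κ → ℝ)
    (PH : ℕ → Finset κ → Finset κ × Finset (κ × κ)) (enum : Finset (κ × κ) → Fin M → κ × κ) (R q : ℕ)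
    (st : Finset κ × Finset κ × κ) (a : Fin M → ℝ) : Finset κ × Finset κ × κ :=
  if q < R then (survivors w st.1 (PH q st.1) (enum (PH q st.1).2) a, st.2.1 ∪ (PH q st.1).1, st.2.2)
  else (st.1, st.2.1, minDistance w (st.1 ∪ st.2.1)
    (enum ((st.1 ∪ st.2.1) ×ˢ (st.1 ∪ st.2.1))) a st.2.2)

/-- The queries of one round of the selection algorithm. -/
def selectionAsk (PH : ℕ → Finset κ → Finset κ × Finset (κ × κ))
    (enum : Finset (κ × κ) → Fin M → κ × κ) (R q : ℕ) (st : Finset κ × Finset κ × κ) :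
    Fin M → κ × κ :=
  if q < R then enum (PH q st.1).2 else enum ((st.1 ∪ st.2.1) ×ˢ (st.1 ∪ st.2.1))

-- Every round has exactly `M` slots. Spare ones hold an arbitrary pair, hence the membership tests
-- in `survivors` and `score`.
omit [DecidableEq κ] [Fintype κ] in
theorem exists_enumeration [Nonempty κ] (H : Finset (κ × κ)) :
    ∃ f : Fin M → κ × κ, H.card ≤ M → ∀ e ∈ H, ∃ b, f b = e := by
  by_cases h : H.card ≤ M
  · refine ⟨fun b => if hb : (b : ℕ) < H.card then H.equivFin.symm ⟨b, hb⟩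
      else Classical.arbitrary _, fun _ e he => ?_⟩
    refine ⟨⟨H.equivFin ⟨e, he⟩, (H.equivFin ⟨e, he⟩).2.trans_le h⟩, ?_⟩
    simp
  · exact ⟨fun _ => Classical.arbitrary _, fun h' => absurd h' h⟩

/-- With accurate answers the selection algorithm loses a factor of at most `15`. -/
theorem selection_le {w : κ → κ × κ → ℝ} {d : κ → κ → ℝ} {D : κ → ℝ} {v : κ × κ → ℝ} {τ : ℝ}
    (hτ : 0 ≤ τ) (hD : ∀ i, 0 ≤ D i) (hvw : ∀ i e, |v e - w i e| ≤ D i)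
    (hw : ∀ i j, d i j - τ ≤ w i (i, j) - w j (i, j)) (hDd : ∀ i j, D i ≤ D j + d i j)
    (hsymm : ∀ i j, d i j = d j i)
    {PH : ℕ → Finset κ → Finset κ × Finset (κ × κ)} {u : ℕ → ℕ} (hu : ∀ q, 1 ≤ u q)
    (hP : ∀ q V, (PH q V).1.card ≤ 2 * (2 * u q) ^ 2)
    (hH : ∀ q V, (PH q V).2.card ≤ V.card * (2 * u q))
    (hfar : ∀ q V, ∀ e ∈ (PH q V).2, (∃ c ∈ (PH q V).1, d e.1 c ≤ 2 * d e.1 e.2) ∧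
      ∃ c ∈ (PH q V).1, d e.2 c ≤ 2 * d e.1 e.2)
    (hindep : ∀ q V, ∀ W ⊆ V \ (PH q V).1, (∀ e ∈ (PH q V).2, ¬ (e.1 ∈ W ∧ e.2 ∈ W)) →
      W.card * (2 * u q) ≤ 2 * V.card)
    {enum : Finset (κ × κ) → Fin M → κ × κ}
    (henum : ∀ H : Finset (κ × κ), H.card ≤ M → ∀ e ∈ H, ∃ b, enum H b = e) {R : ℕ}
    (hcost : ∀ q < R, Fintype.card κ * (2 * u q) ≤ M * ∏ r ∈ Finset.range q, u r)
    (hfinal : ∀ x, x * ∏ r ∈ Finset.range R, u r ≤ Fintype.card κ →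
      (x + ∑ r ∈ Finset.range R, 2 * (2 * u r) ^ 2) ^ 2 ≤ M)
    (i₀ : κ) {a : ℕ → Fin M → ℝ}
    (ha : ∀ q < R + 1, ∀ b, |a q b - v (selectionAsk PH enum R q
      (run (Finset.univ, ∅, i₀) (selectionStep w PH enum R) a q) b)| ≤ τ) (i : κ) :
    D (run (Finset.univ, ∅, i₀) (selectionStep w PH enum R) a (R + 1)).2.2 ≤
      15 * D i + 21 * τ := by
  set st := run (Finset.univ, ∅, i₀) (selectionStep w PH enum R) a with hst
  have hstep : ∀ q < R, st (q + 1) = (survivors w (st q).1 (PH q (st q).1)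
      (enum (PH q (st q).1).2) (a q), (st q).2.1 ∪ (PH q (st q).1).1, (st q).2.2) := by
    intro q hq
    rw [hst, run, selectionStep, if_pos hq]
  have hask : ∀ q < R, ∀ b, |a q b - v (enum (PH q (st q).1).2 b)| ≤ τ := by
    intro q hq b
    have := ha q (by omega) b
    rwa [selectionAsk, if_pos hq] at this
  have hprod : ∀ q, 0 < ∏ r ∈ Finset.range q, u r := fun q => Finset.prod_pos fun r _ => hu r
  -- Round `q` divides the number of candidates by at least `u q`; the bound for `q` also ensures
  -- that the pairs of that round fit into the `M` slots.
  have hsize : ∀ q ≤ R, (st q).1.card * ∏ r ∈ Finset.range q, u r ≤ Fintype.card κ := by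
    intro q
    induction q with
    | zero => intro _; simp [hst, run]
    | succ q ih =>
      intro hq
      have ihq := ih (by omega)
      have hM : (PH q (st q).1).2.card ≤ M := by
        refine (hH q _).trans (Nat.le_of_mul_le_mul_right ?_ (hprod q))
        refine le_trans ?_ (hcost q (by omega))
        rw [mul_right_comm]
        exact Nat.mul_le_mul_right _ ihq
      have h1 := hindep q (st q).1 (st (q + 1)).1 (by
        rw [hstep q (by omega)]
        exact Finset.filter_subset _ _) (by
        rw [hstep q (by omega)]
        rintro e he ⟨h1, h2⟩
        obtain ⟨b, hb⟩ := henum _ hM e he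
        have h3 := (Finset.mem_filter.mp h1).2 b (hb ▸ he)
        have h4 := (Finset.mem_filter.mp h2).2 b (hb ▸ he)
        rw [hb, loser] at h3 h4
        split_ifs at h3 h4
        · exact h3 rfl
        · exact h4 rfl)
      rw [Finset.prod_range_succ]
      calc (st (q + 1)).1.card * ((∏ r ∈ Finset.range q, u r) * u q)
          = ((st (q + 1)).1.card * u q) * ∏ r ∈ Finset.range q, u r := by ring
        _ ≤ (st q).1.card * ∏ r ∈ Finset.range q, u r := Nat.mul_le_mul_right _ (by nlinarith)
        _ ≤ _ := ihq
  have hpool : ∀ q ≤ R, (st q).2.1.card ≤ ∑ r ∈ Finset.range q, 2 * (2 * u r) ^ 2 := by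
    intro q
    induction q with
    | zero => intro _; simp [hst, run]
    | succ q ih =>
      intro hq
      rw [hstep q (by omega), Finset.sum_range_succ]
      exact (Finset.card_union_le _ _).trans (add_le_add (ih (by omega)) (hP q _))
  -- Either `i` is still a candidate or a good substitute was put aside. If `i` loses, a
  -- representative lies within `2 * (2 * D i + 3 * τ)`, whence `5 * D i + 6 * τ`. Representatives
  -- are never removed, so this loss is not compounded.
  have hgood : ∀ q ≤ R, ∃ c, (c = i ∧ c ∈ (st q).1 ∨ c ∈ (st q).2.1) ∧ D c ≤ 5 * D i + 6 * τ := by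
    intro q
    induction q with
    | zero => exact fun _ => ⟨i, Or.inl ⟨rfl, by simp [hst, run]⟩, by linarith [hD i]⟩
    | succ q ih =>
      intro hq
      rw [hstep q (by omega)]
      obtain ⟨c, ⟨rfl, hc⟩ | hc, hDc⟩ := ih (by omega)
      · by_cases hcP : c ∈ (PH q (st q).1).1
        · exact ⟨c, Or.inr (Finset.mem_union_right _ hcP), hDc⟩
        by_cases hlose : ∀ b, enum (PH q (st q).1).2 b ∈ (PH q (st q).1).2 →
            loser w (enum (PH q (st q).1).2 b) (a q b) ≠ c
        · exact ⟨c, Or.inl ⟨rfl, Finset.mem_filter.mpr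
            ⟨Finset.mem_sdiff.mpr ⟨hc, hcP⟩, hlose⟩⟩, hDc⟩
        push Not at hlose
        obtain ⟨b, hb, hlb⟩ := hlose
        have h1 := dist_loser_le hvw hw (hask q (by omega) b)
        rw [hlb] at h1
        have h2 : ∃ c' ∈ (PH q (st q).1).1, d c' c ≤ 2 * (2 * D c + 3 * τ) := by
          obtain ⟨⟨c₁, hc₁, h₁⟩, c₂, hc₂, h₂⟩ := hfar q _ _ hb
          rw [loser] at hlb
          split_ifs at hlb
          · rw [hlb] at h₁
            exact ⟨c₁, hc₁, by rw [hsymm]; rw [hlb] at h1; linarith⟩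
          · rw [hlb] at h₂
            exact ⟨c₂, hc₂, by rw [hsymm]; rw [hlb] at h1; linarith⟩
        obtain ⟨c', hc', hcc'⟩ := h2
        exact ⟨c', Or.inr (Finset.mem_union_right _ hc'), by linarith [hDd c' c]⟩
      · exact ⟨c, Or.inr (Finset.mem_union_left _ hc), hDc⟩
  obtain ⟨c, hc, hDc⟩ := hgood R le_rfl
  set G := (st R).1 ∪ (st R).2.1 with hG
  have hcG : c ∈ G := by
    rcases hc with hc | hc
    · exact Finset.mem_union_left _ hc.2
    · exact Finset.mem_union_right _ hc
  have hGM : (G ×ˢ G).card ≤ M := by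
    rw [Finset.card_product, ← sq]
    refine le_trans (Nat.pow_le_pow_left ?_ 2) (hfinal (st R).1.card (hsize R le_rfl))
    exact (Finset.card_union_le _ _).trans (Nat.add_le_add_left (hpool R le_rfl) _)
  have hlast : (st (R + 1)).2.2 = minDistance w G (enum (G ×ˢ G)) (a R) (st R).2.2 := by
    rw [hst, run, selectionStep, if_neg (lt_irrefl R)]
  rw [hlast]
  have h := minDistance_le (a := a R) hτ hD hvw hw hDd (henum _ hGM) (fun b => by
    have := ha R (by omega) b
    rwa [selectionAsk, if_neg (lt_irrefl R)] at this) hcG (st R).2.2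
  linarith

end Selection

/-! ### Schedule of group sizes and numerical bounds -/

section Parameters

theorem sq_add_five_le (U : ℕ) : (U + 5) ^ 2 ≤ 25 * 16 ^ U := by
  induction U with
  | zero => norm_num
  | succ U ih => 
    calc (U + 1 + 5) ^ 2 ≤ (4 * (U + 5)) ^ 2 := Nat.pow_le_pow_left (by omega) 2
      _ = 16 * (U + 5) ^ 2 := by ring
      _ ≤ 16 * (25 * 16 ^ U) := Nat.mul_le_mul_left _ ih
      _ = 25 * 16 ^ (U + 1) := by ring

/-- Group sizes which grow doubly exponentially. -/
theorem exists_schedule {k : ℕ} (hk : 3 ≤ k) :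
    ∃ (R : ℕ) (u : ℕ → ℕ), R = Nat.clog 2 (Nat.clog 2 k / 8 + 1) + 4 ∧ (∀ q, 1 ≤ u q) ∧
      (∀ q < R, k * (2 * u q) ≤ 200000 * k * ∏ r ∈ Finset.range q, u r) ∧
      ∀ x, x * ∏ r ∈ Finset.range R, u r ≤ k →
        (x + ∑ r ∈ Finset.range R, 2 * (2 * u r) ^ 2) ^ 2 ≤ 200000 * k := by
  set L := Nat.clog 2 k with hL
  set U := L / 8 with hU
  set R₀ := Nat.clog 2 (U + 1) with hR₀
  -- The cap bounds the squared number of representatives by a multiple of `(U + 5) ^ 2 * 16 ^ U`,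
  -- hence of `256 ^ U ≤ 2 ^ L`. This is why `U` is `L / 8`.
  set e : ℕ → ℕ := fun q => min (2 ^ q) (U + 1) with he
  have hkL : k ≤ 2 ^ L := Nat.le_pow_clog (by norm_num) k
  have hLk : 2 ^ L ≤ 2 * k := by
    have h1 := Nat.pow_pred_clog_lt_self (b := 2) (by norm_num) (x := k) (by omega)
    have h2 : 0 < L := Nat.clog_pos (by norm_num) (by omega)
    obtain ⟨l, hl⟩ := Nat.exists_eq_succ_of_ne_zero h2.ne'
    rw [← hL, hl, Nat.pred_succ] at h1
    rw [hl, pow_succ]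
    omega
  have hR₀U : R₀ ≤ U + 1 := Nat.clog_le_of_le_pow Nat.lt_two_pow_self.le
  have hUR₀ : U + 1 ≤ 2 ^ R₀ := Nat.le_pow_clog (by norm_num) _
  have hprod : ∀ q, ∏ r ∈ Finset.range q, 2 ^ e r = 2 ^ ∑ r ∈ Finset.range q, e r := fun q =>
    Finset.prod_pow_eq_pow_sum _ _ _
  -- Doubling exponents exceed the sum of their predecessors by at most one, so a round needs at
  -- most `4 * k` tests.
  have hsum : ∀ q, e q ≤ (∑ r ∈ Finset.range q, e r) + 1 := by
    intro q
    induction q with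
    | zero => simp [he]
    | succ q ih =>
      rw [Finset.sum_range_succ]
      have : e (q + 1) ≤ 2 * e q := by
        simp only [he, pow_succ]
        omega
      omega
  have hlarge : ∀ q, R₀ ≤ q → e q = U + 1 := fun q hq =>
    min_eq_right (hUR₀.trans (Nat.pow_le_pow_right (by norm_num) hq))
  refine ⟨R₀ + 4, fun q => 2 ^ e q, rfl, fun q => Nat.one_le_two_pow, fun q _ => ?_, fun x hx => ?_⟩
  · rw [hprod]
    have h1 : 2 ^ e q ≤ 2 * 2 ^ ∑ r ∈ Finset.range q, e r := by
      rw [← pow_succ']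
      exact Nat.pow_le_pow_right (by norm_num) (hsum q)
    calc k * (2 * 2 ^ e q) ≤ k * (2 * (2 * 2 ^ ∑ r ∈ Finset.range q, e r)) := by gcongr
      _ = 4 * k * 2 ^ ∑ r ∈ Finset.range q, e r := by ring
      _ ≤ _ := by gcongr; norm_num
  · rw [hprod] at hx
    -- The last four rounds, all at the cap, contribute `4 * (U + 1) ≥ L / 2`: the candidates shrink
    -- by at least `√k`.
    have hexp : L ≤ 2 * ∑ r ∈ Finset.range (R₀ + 4), e r := by
      simp only [Finset.sum_range_succ]
      rw [hlarge R₀ le_rfl, hlarge (R₀ + 1) (by omega), hlarge (R₀ + 2) (by omega),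
        hlarge (R₀ + 3) (by omega)]
      omega
    have hx2 : x ^ 2 ≤ k := by
      refine Nat.le_of_mul_le_mul_right (c := k) ?_ (by omega)
      calc x ^ 2 * k ≤ x ^ 2 * 2 ^ (2 * ∑ r ∈ Finset.range (R₀ + 4), e r) := by
            gcongr
            exact hkL.trans (Nat.pow_le_pow_right (by norm_num) hexp)
        _ = (x * 2 ^ ∑ r ∈ Finset.range (R₀ + 4), e r) ^ 2 := by rw [mul_pow, ← pow_mul, mul_comm 2]
        _ ≤ k ^ 2 := Nat.pow_le_pow_left hx 2
        _ = k * k := sq k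
    have hpool : ∑ r ∈ Finset.range (R₀ + 4), 2 * (2 * 2 ^ e r) ^ 2 ≤ (U + 5) * (32 * 4 ^ U) := by
      calc ∑ r ∈ Finset.range (R₀ + 4), 2 * (2 * 2 ^ e r) ^ 2
          ≤ ∑ r ∈ Finset.range (R₀ + 4), 32 * 4 ^ U := by
            refine Finset.sum_le_sum fun r _ => ?_
            calc 2 * (2 * 2 ^ e r) ^ 2 ≤ 2 * (2 * 2 ^ (U + 1)) ^ 2 := by
                  gcongr
                  · norm_num
                  · exact min_le_right _ _
              _ = 32 * (2 ^ 2) ^ U := by rw [← pow_mul]; ring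
              _ = 32 * 4 ^ U := by norm_num
        _ = (R₀ + 4) * (32 * 4 ^ U) := by simp
        _ ≤ (U + 5) * (32 * 4 ^ U) := Nat.mul_le_mul_right _ (by omega)
    have hpool2 : (∑ r ∈ Finset.range (R₀ + 4), 2 * (2 * 2 ^ e r) ^ 2) ^ 2 ≤ 51200 * k := by
      calc (∑ r ∈ Finset.range (R₀ + 4), 2 * (2 * 2 ^ e r) ^ 2) ^ 2
          ≤ ((U + 5) * (32 * 4 ^ U)) ^ 2 := Nat.pow_le_pow_left hpool 2
        _ = (U + 5) ^ 2 * (1024 * (4 ^ 2) ^ U) := by rw [← pow_mul]; ring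
        _ ≤ (25 * 16 ^ U) * (1024 * (4 ^ 2) ^ U) := Nat.mul_le_mul_right _ (sq_add_five_le U)
        _ = 25600 * (2 ^ 8) ^ U := by
            rw [show (2 : ℕ) ^ 8 = 16 * 16 by norm_num, mul_pow 16 16]; norm_num; ring
        _ = 25600 * 2 ^ (8 * U) := by rw [pow_mul]
        _ ≤ 25600 * 2 ^ L := by
            gcongr
            · norm_num
            · omega
        _ ≤ 51200 * k := by omega
    nlinarith [two_mul_le_add_sq x
      (∑ r ∈ Finset.range (R₀ + 4), 2 * (2 * 2 ^ e r) ^ 2)]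

theorem clog_two_le {x : ℕ} (hx : 1 ≤ x) : (Nat.clog 2 x : ℝ) ≤ 1 + 2 * Real.log x := by
  rcases hx.eq_or_lt with rfl | hx
  · simp
  have h1 := Nat.pow_pred_clog_lt_self (b := 2) (by norm_num) (x := x) (by omega)
  have h2 : 0 < Nat.clog 2 x := Nat.clog_pos (by norm_num) (by omega)
  obtain ⟨l, hl⟩ := Nat.exists_eq_succ_of_ne_zero h2.ne'
  rw [hl, Nat.pred_succ] at h1
  have h3 : (l : ℝ) * Real.log 2 ≤ Real.log x := by
    rw [← Real.log_pow]
    exact Real.log_le_log (by positivity) (by exact_mod_cast h1.le)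
  have h4 : (1 : ℝ) / 2 ≤ Real.log 2 := by linarith [Real.log_two_gt_d9]
  have h5 : (0 : ℝ) ≤ l := Nat.cast_nonneg l
  rw [hl]
  push_cast
  nlinarith

theorem one_lt_log_three : 1 < Real.log 3 := by
  rw [Real.lt_log_iff_exp_lt (by norm_num)]
  linarith [Real.exp_one_lt_d9]

theorem log_log_three_pos : 0 < Real.log (Real.log 3) := Real.log_pos one_lt_log_three

theorem log_log_three_le {k : ℕ} (hk : 3 ≤ k) :
    Real.log (Real.log 3) ≤ Real.log (Real.log k) :=
  Real.log_le_log (zero_lt_one.trans one_lt_log_three)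
    (Real.log_le_log (by norm_num) (by exact_mod_cast hk))

theorem one_lt_log {k : ℕ} (hk : 3 ≤ k) : 1 < Real.log k :=
  one_lt_log_three.trans_le (Real.log_le_log (by norm_num) (by exact_mod_cast hk))

/-- As `log log k` is positive but small at `k = 3`, the additive constant 10 is absorbed through
division by `log log 3`. -/
theorem rounds_le {k : ℕ} (hk : 3 ≤ k) :
    ((Nat.clog 2 (Nat.clog 2 k / 8 + 1) + 4 + 1 : ℕ) : ℝ) ≤
      (10 / Real.log (Real.log 3) + 2) * Real.log (Real.log k) := by
  have hlog := one_lt_log hk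
  have h1 := clog_two_le (x := k) (by omega)
  have h2 := clog_two_le (x := Nat.clog 2 k / 8 + 1) (by omega)
  have h3 : ((Nat.clog 2 k / 8 + 1 : ℕ) : ℝ) ≤ 3 * Real.log k := by
    have : ((Nat.clog 2 k / 8 : ℕ) : ℝ) ≤ (Nat.clog 2 k : ℝ) / 8 := Nat.cast_div_le
    push_cast
    linarith
  have h4 : Real.log ((Nat.clog 2 k / 8 + 1 : ℕ) : ℝ) ≤ 2 + Real.log (Real.log k) := by
    refine (Real.log_le_log (by positivity) h3).trans ?_
    rw [Real.log_mul (by norm_num) (by positivity)]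
    have : Real.log 3 ≤ 2 := by
      have := Real.log_le_sub_one_of_pos (show (0 : ℝ) < 3 by norm_num)
      linarith
    linarith
  have h5 : 10 ≤ 10 / Real.log (Real.log 3) * Real.log (Real.log k) := by
    rw [div_mul_eq_mul_div, le_div_iff₀ log_log_three_pos]
    linarith [log_log_three_le hk]
  push_cast at *
  linarith

theorem rounds_le_mul (k : ℕ) (hk : 3 ≤ k) :
    Nat.clog 2 (Nat.clog 2 k / 8 + 1) + 4 + 1 ≤ 3 * k := by
  have h1 : Nat.clog 2 k ≤ k := Nat.clog_le_of_le_pow Nat.lt_two_pow_self.le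
  have h2 : Nat.clog 2 (Nat.clog 2 k / 8 + 1) ≤ Nat.clog 2 k / 8 + 1 :=
    Nat.clog_le_of_le_pow Nat.lt_two_pow_self.le
  omega

theorem quarter_le_bias {ε : ℝ} (hε : 0 < ε) (hε1 : ε ≤ 1) :
    ε / 4 ≤ (Real.exp ε - 1) / (Real.exp ε + 1) := by
  have h1 := Real.add_one_le_exp ε
  have h2 : Real.exp ε ≤ 3 :=
    (Real.exp_le_exp.mpr hε1).trans (by linarith [Real.exp_one_lt_d9])
  rw [div_le_div_iff₀ (by norm_num) (by positivity)]
  nlinarith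

/-- With `m` individuals per query all queries are answered accurately with high probability. -/
theorem failure_le {k t m : ℕ} (hk : 3 ≤ k) (ht : t ≤ 3 * k) {ε α : ℝ} (hε : 0 < ε) (hε1 : ε ≤ 1)
    (hα : 0 < α) (hm : 70560 * Real.log k / (ε ^ 2 * α ^ 2) ≤ m) :
    (Fintype.card (Fin k × Fin k) * (t * (200000 * k : ℕ)) : ℝ) *
      (2 * Real.exp (-(2 * m * ((Real.exp ε - 1) / (Real.exp ε + 1) * (α / 21)) ^ 2))) ≤ 1 / 10 := by
  have hk0 : (0 : ℝ) < k := by positivity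
  have hk3 : (3 : ℝ) ≤ k := by exact_mod_cast hk
  have ht' : (t : ℝ) ≤ 3 * k := by exact_mod_cast ht
  -- The slope is at least `ε / 4` and `70560 = 10 * 84 ^ 2`, where `84 = 4 * 21`.
  have h1 : 20 * Real.log k ≤ 2 * m * ((Real.exp ε - 1) / (Real.exp ε + 1) * (α / 21)) ^ 2 := by
    rw [div_le_iff₀ (by positivity)] at hm
    have h2 : ε / 4 * (α / 21) ≤ (Real.exp ε - 1) / (Real.exp ε + 1) * (α / 21) :=
      mul_le_mul_of_nonneg_right (quarter_le_bias hε hε1) (by positivity)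
    calc 20 * Real.log k ≤ 2 * m * (ε / 4 * (α / 21)) ^ 2 := by ring_nf at hm ⊢; linarith
      _ ≤ _ := by gcongr
  have h3 : Real.exp (-(2 * m * ((Real.exp ε - 1) / (Real.exp ε + 1) * (α / 21)) ^ 2)) ≤
      1 / (k : ℝ) ^ 20 := by
    refine (Real.exp_le_exp.mpr (neg_le_neg h1)).trans_eq ?_
    rw [Real.exp_neg, one_div, show 20 * Real.log k = ((20 : ℕ) : ℝ) * Real.log k by norm_num,
      Real.exp_nat_mul, Real.exp_log hk0]
  have h4 : (3 : ℝ) ^ 16 ≤ (k : ℝ) ^ 16 := pow_le_pow_left₀ (by norm_num) hk3 16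
  calc (Fintype.card (Fin k × Fin k) * (t * (200000 * k : ℕ)) : ℝ) *
      (2 * Real.exp (-(2 * m * ((Real.exp ε - 1) / (Real.exp ε + 1) * (α / 21)) ^ 2)))
      ≤ ((k * k) * ((3 * k) * (200000 * k))) * (2 * (1 / (k : ℝ) ^ 20)) := by
        rw [Fintype.card_prod, Fintype.card_fin]
        push_cast
        gcongr
    _ = 1200000 / (k : ℝ) ^ 16 := by field_simp; ring
    _ ≤ 1 / 10 := by
        rw [div_le_div_iff₀ (by positivity) (by norm_num)]
        norm_num at h4 ⊢
        linarith

end Parameters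

/-! ### Assembly of the protocol and the main theorem -/

/-- Hypothesis selection by a protocol with given numbers of rounds, queries and individuals. -/
theorem exists_selection_protocol {𝒳 : Type*} [MeasurableSpace 𝒳] {k : ℕ} (hk : 3 ≤ k) {ε α : ℝ}
    (hε : 0 < ε) (hε1 : ε ≤ 1) (hα : 0 < α) {m : ℕ}
    (hm : 70560 * Real.log k / (ε ^ 2 * α ^ 2) ≤ m) (Q : Fin k → Measure 𝒳)
    (hQ : ∀ i, IsProbabilityMeasure (Q i)) :
    ∃ P : Protocol 𝒳 ((Nat.clog 2 (Nat.clog 2 k / 8 + 1) + 4 + 1) * (200000 * k) * m)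
        (Nat.clog 2 (Nat.clog 2 k / 8 + 1) + 4 + 1),
      P.IsSequentiallyInteractive ∧ P.IsLDP ε ∧
      ∃ output : P.Transcript → Fin k, Measurable output ∧
        ∀ p : Measure 𝒳, IsProbabilityMeasure p →
          9 / 10 ≤ (P.experiment p).real
            {xc | ∀ i, tvDist p (Q (output (P.transcript xc.1 xc.2))) ≤
              15 * tvDist p (Q i) + α} := by
  obtain ⟨R, u, hR, hu, hcost, hfinal⟩ := exists_schedule hk
  rw [← hR]
  have hm0 : 0 < m := by
    have h1 := one_lt_log hk
    have : (0 : ℝ) < m := lt_of_lt_of_le (by positivity) hm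
    exact_mod_cast this
  have : Nonempty (Fin k) := ⟨⟨0, by omega⟩⟩
  -- The total additive error in `selection_le` is `21 * τ`.
  have hτ : 0 < α / 21 := by positivity
  choose PH hP hH hfar hindep using fun (q : ℕ) (V : Finset (Fin k)) =>
    exists_round (fun i j => tvDist (Q i) (Q j)) (fun i => tvDist_self _)
      (fun i j => tvDist_nonneg _ _) (fun i j => tvDist_comm _ _)
      (fun i j l => tvDist_triangle _ _ _) V (2 * u q) (by have := hu q; omega)
  choose enum henum using fun H : Finset (Fin k × Fin k) => exists_enumeration (M := 200000 * k) H
  choose S hS hSd using fun e : Fin k × Fin k => exists_tvDist_sub_le (Q e.1) (Q e.2) hτ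
  set w : Fin k → Fin k × Fin k → ℝ := fun i e => (Q i).real (S e) with hw
  obtain ⟨P, hPS, hPL, output, hmeas, hgood⟩ := exists_protocol (κ := Fin k) hε hτ (R + 1)
    (200000 * k) m hm0 (failure_le hk (by rw [hR]; exact rounds_le_mul k hk) hε hε1 hα hm) S hS
    ((Finset.univ, ∅, Classical.arbitrary (Fin k)) : Finset (Fin k) × Finset (Fin k) × Fin k)
    (selectionAsk PH enum R) (selectionStep w PH enum R) (fun st => st.2.2)
  refine ⟨P, hPS, hPL, output, hmeas, fun p hp => (hgood p hp).trans ?_⟩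
  have hfin : IsProbabilityMeasure (P.experiment p) :=
    inferInstanceAs (IsProbabilityMeasure ((Measure.pi fun _ => p).prod
      (Measure.pi fun _ => Measure.pi fun _ => P.coinLaw)))
  refine measureReal_mono ?_
  rintro xc ⟨a, ha, hout⟩ i
  rw [hout]
  have h := selection_le (D := fun i => tvDist p (Q i)) (v := fun e => p.real (S e)) (w := w)
    hτ.le (fun i => tvDist_nonneg _ _) (fun i e => abs_sub_le_tvDist _ _ (hS e))
    (fun i j => hSd (i, j))
    (fun i j => by
      rw [tvDist_comm (Q i) (Q j)]
      exact tvDist_triangle p (Q j) (Q i))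
    (fun i j => tvDist_comm _ _) hu hP hH hfar hindep henum
    (by simpa using hcost) (by simpa using hfinal) (Classical.arbitrary (Fin k)) ha i
  linarith

theorem mainTheorem3 :
    ∀ γ : ℝ, 0 < γ → ∃ C : ℝ, 0 < C ∧
      ∀ (k : ℕ) (ε α : ℝ), 3 ≤ k → 0 < ε → ε ≤ 1 → 0 < α →
        ∃ n t : ℕ,
          (n : ℝ) ≤ C * (k * Real.log k * Real.log (Real.log k) / (ε ^ 2 * α ^ 2)) ∧
          (t : ℝ) ≤ C * Real.log (Real.log k) ∧
          ∀ (𝒳 : Type*) [MeasurableSpace 𝒳] (Q : Fin k → Measure 𝒳),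
            (∀ i, IsProbabilityMeasure (Q i)) →
            ∃ P : Protocol 𝒳 n t, P.IsSequentiallyInteractive ∧ P.IsLDP ε ∧
              ∃ output : P.Transcript → Fin k, Measurable output ∧
                ∀ p : Measure 𝒳, IsProbabilityMeasure p →
                  9 / 10 ≤ (P.experiment p).real
                    {xc | tvDist p (Q (output (P.transcript xc.1 xc.2))) ≤
                      (27 + γ) * (⨅ i, tvDist p (Q i)) + α} := by
  intro γ hγ
  have hC₁ : 0 < 10 / Real.log (Real.log 3) + 2 := by
    have := log_log_three_pos
    positivity
  set C₁ := 10 / Real.log (Real.log 3) + 2 with hC₁def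
  -- `C₁` counts rounds, `200000 * k` the slots per round, and `141120 = 2 * 70560` the individuals
  -- per slot after rounding up.
  refine ⟨C₁ * (200000 * 141120), by positivity, fun k ε α hk hε hε1 hα => ?_⟩
  have hloglog : 0 < Real.log (Real.log k) := log_log_three_pos.trans_le (log_log_three_le hk)
  have hlog := one_lt_log hk
  have hne : Nonempty (Fin k) := ⟨⟨0, by omega⟩⟩
  -- For `α ≥ 1` any output works, with no individuals; `0 * 0 * 1` matches the shape `t * M * m`.
  -- For `α < 1` the group size `x` is at least 1, so rounding up at most doubles it.
  rcases le_or_gt 1 α with hα1 | hα1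
  · refine ⟨0 * 0 * 1, 0, ?_, ?_, fun 𝒳 _ Q hQ => ?_⟩
    · simp only [zero_mul, Nat.cast_zero]
      positivity
    · simp only [Nat.cast_zero]
      positivity
    · obtain ⟨P, hPS, hPL, output, hmeas, hgood⟩ := exists_protocol (𝒳 := 𝒳) (ι := Fin 1)
        (σ := Fin 1) (κ := Fin k) hε one_pos 0 0 1 one_pos (by simp) (fun _ => ∅)
        (fun _ => MeasurableSet.empty) 0 (fun _ _ _ => 0) (fun _ _ _ => 0)
        (fun _ => Classical.arbitrary _)
      refine ⟨P, hPS, hPL, output, hmeas, fun p hp => (hgood p hp).trans ?_⟩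
      have hfin : IsProbabilityMeasure (P.experiment p) :=
        inferInstanceAs (IsProbabilityMeasure ((Measure.pi fun _ => p).prod
          (Measure.pi fun _ => Measure.pi fun _ => P.coinLaw)))
      refine measureReal_mono fun xc _ => ?_
      have h1 : 0 ≤ ⨅ i, tvDist p (Q i) := le_ciInf fun i => tvDist_nonneg _ _
      have h2 := tvDist_le_one p (Q (output (P.transcript xc.1 xc.2)))
      have h3 : 0 ≤ (27 + γ) * ⨅ i, tvDist p (Q i) := by positivity
      exact Set.mem_ofPred_eq ▸ (by linarith)
  set x := 70560 * Real.log k / (ε ^ 2 * α ^ 2) with hx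
  have hx1 : 1 ≤ x := by
    rw [hx, le_div_iff₀ (by positivity)]
    have h1 : ε ^ 2 * α ^ 2 ≤ 1 := mul_le_one₀ (pow_le_one₀ hε.le hε1) (by positivity)
      (pow_le_one₀ hα.le hα1.le)
    linarith
  have hm : (⌈x⌉₊ : ℝ) ≤ 2 * x := by linarith [Nat.ceil_lt_add_one (zero_le_one.trans hx1)]
  have ht := rounds_le hk
  refine ⟨(Nat.clog 2 (Nat.clog 2 k / 8 + 1) + 4 + 1) * (200000 * k) * ⌈x⌉₊,
    Nat.clog 2 (Nat.clog 2 k / 8 + 1) + 4 + 1, ?_, ?_, fun 𝒳 _ Q hQ => ?_⟩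
  · rw [Nat.cast_mul, Nat.cast_mul]
    calc _ ≤ (C₁ * Real.log (Real.log k)) * ((200000 * k : ℕ) : ℝ) * (2 * x) := by gcongr
      _ = _ := by rw [hx]; push_cast; ring
  · refine ht.trans (mul_le_mul_of_nonneg_right ?_ hloglog.le)
    nlinarith
  · obtain ⟨P, hPS, hPL, output, hmeas, hgood⟩ :=
      exists_selection_protocol hk hε hε1 hα (Nat.le_ceil x) Q hQ
    refine ⟨P, hPS, hPL, output, hmeas, fun p hp => (hgood p hp).trans ?_⟩
    have hfin : IsProbabilityMeasure (P.experiment p) :=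
      inferInstanceAs (IsProbabilityMeasure ((Measure.pi fun _ => p).prod
        (Measure.pi fun _ => Measure.pi fun _ => P.coinLaw)))
    refine measureReal_mono fun xc hxc => ?_
    obtain ⟨i, hi⟩ := exists_eq_ciInf_of_finite (f := fun i => tvDist p (Q i))
    have h1 := hxc i
    have h2 := tvDist_nonneg p (Q i)
    have h3 : tvDist p (Q (output (P.transcript xc.1 xc.2))) ≤
        (27 + γ) * (⨅ i, tvDist p (Q i)) + α := by
      rw [← hi]
      nlinarith
    exact h3
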